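/- Let $k\ge 2$ and $n\ge 0$ be integers. Let $C_k$ be the cycle graph with vertices $v_i$ and edges $e_i$, $i\in\mathbb Z_k=\mathbb Z/k\mathbb Z$, where $e_i$ has end points $v_i,v_{i+1}$ and is oriented from $v_i$ to $v_{i+1}$. A vertex-edge $n$-tuple is a tuple $\sigma=(\sigma_1,\dots,\sigma_n)$ in which each $\sigma_j$ is a vertex or an edge of $C_k$; its dimension $\dim\sigma$ is the number of positions $j$ at which $\sigma_j$ is an edge, and $\mathrm{supp}_V(\sigma)=\{i\in\mathbb Z_k : v_i\in\{\sigma_1,\dots,\sigma_n\}\}$. For $P\subseteq\mathbb Z_k$ and an integer $q\ge 0$, let $\mathcal C^{P,q}$ be the chain complex whose group $C^{P,q}_d$ is free abelian on the vertex-edge $n$-tuples $\sigma$ with $\dim\sigma=d$, $\mathrm{supp}_V(\sigma)\subseteq P$ and $|\mathrm{supp}_V(\sigma)|\ge q$, with boundary operator $$\partial\sigma=\sum_{j:\ \sigma_j=e_i\text{ is an edge}}(-1)^{\rho(\sigma,j)}\bigl([i+1\in P]\,\sigma[j\to v_{i+1}]-[i\in P]\,\sigma[j\to v_i]\bigr),$$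 where $\rho(\sigma,j)$ is the number of positions $l<j$ at which $\sigma_l$ is an edge, $\sigma[j\to v]$ is $\sigma$ with its $j$-th entry replaced by $v$, and $[\cdot]$ is $1$ if the condition holds and $0$ otherwise. (1) The complex $\mathcal C^{\mathbb Z_k,0}$ calculates the homology of the $n$-torus: $H_i(\mathcal C^{\mathbb Z_k,0})\cong H_i((\mathbb R/\mathbb Z)^n;\mathbb Z)$ (singular homology) for all $i$. In fact, it is the cubical chain complex of the $n$-fold direct product $C_k\times\dots\times C_k$ of the one-dimensional cubical complex $C_k$: there is an isomorphism of chain complexes that sends each generator $\sigma$ to the cell $\sigma_1\times\dots\times\sigma_n$. (The cubical boundary of a $d$-dimensional cell is $\sum_{i=0}^{d-1}(-1)^i$ times the front face minus the back face in its $i$-th direction, the directions of a product cell being ordered by the factors.) (2) If $P$ is a proper subset of $\mathbb Z_k$ and $h=|\mathbb Z_k\setminus P|$, then $H_n(\mathcal C^{P,0})\cong\mathbb Z^{h^n}$, and $H_i(\mathcal C^{P,0})=0$ for all $i\ne n$. -/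

import Mathlib

open CategoryTheory

/-!
Chain complexes are `ChainComplex (ModuleCat ℤ) ℕ`, that is, complexes of abelian groups
in non-negative degrees.
-/

/-! ### Cubical complexes and their cubical chain complexes -/

/-- A (combinatorial, oriented) cubical complex: a set of cells with dimensions, in which a cell
`c` of dimension `d` has, for each of its `d` directions `i < d`, a back face `face false i c`
and a front face `face true i c`, of dimension `d - 1`, subject to the cubical identities.
The value of `face ε i c` is irrelevant when `dim c ≤ i`. -/
structure CubicalCx where
  Cell : Type
  dim : Cell → ℕ
  face : Bool → ℕ → Cell → Cell
  dim_face : ∀ ε i c, i < dim c → dim (face ε i c) + 1 = dim c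
  face_face : ∀ ε ε' i j c, i < j → j < dim c →
    face ε i (face ε' j c) = face ε' (j - 1) (face ε i c)

namespace CubicalCx

/-- The one-point cubical complex. -/
def point : CubicalCx where
  Cell := Unit
  dim _ := 0
  face _ _ c := c
  dim_face := by intro _ i _ h; exact absurd h (Nat.not_lt_zero i)
  face_face := by intros; rfl

/-- The direct product of cubical complexes. The cells are the pairs of cells, and the directions
of the cell `(x, y)` are those of `x` followed by those of `y`. -/
def prod (X Y : CubicalCx) : CubicalCx where
  Cell := X.Cell × Y.Cell
  dim c := X.dim c.1 + Y.dim c.2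
  face ε i c := if i < X.dim c.1 then (X.face ε i c.1, c.2)
    else (c.1, Y.face ε (i - X.dim c.1) c.2)
  dim_face := by
    rintro ε i ⟨x, y⟩ h
    simp only at h
    by_cases hi : i < X.dim x
    · have := X.dim_face ε i x hi
      simp only [hi, if_true]; omega
    · have := Y.dim_face ε (i - X.dim x) y (by omega)
      simp only [hi, if_false]; omega
  face_face := by
    rintro ε ε' i j ⟨x, y⟩ hij hj
    simp only at hj
    by_cases hjx : j < X.dim x
    · have hix : i < X.dim x := by omega
      have h1 := X.dim_face ε' j x hjx
      have h2 := X.dim_face ε i x hix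
      have h3 : i < X.dim (X.face ε' j x) := by omega
      have h4 : j - 1 < X.dim (X.face ε i x) := by omega
      simp [hjx, hix, h3, h4, X.face_face ε ε' i j x hij hjx]
    · by_cases hix : i < X.dim x
      · have h2 := X.dim_face ε i x hix
        have h4 : ¬ j - 1 < X.dim (X.face ε i x) := by omega
        have h5 : j - 1 - X.dim (X.face ε i x) = j - X.dim x := by omega
        simp only [hjx, hix, h4, h5, if_true, if_false]
      · have h4 : ¬ j - 1 < X.dim x := by omega
        have h6 : j - 1 - X.dim x = j - X.dim x - 1 := by omega
        have := Y.face_face ε ε' (i - X.dim x) (j - X.dim x) y (by omega) (by omega)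
        simp only [hjx, hix, h4, h6, if_false, this]

/-- The `n`-fold direct product `X × ⋯ × X`. -/
def pow (X : CubicalCx) : ℕ → CubicalCx
  | 0 => point
  | n + 1 => X.prod (X.pow n)

/-- The cell `σ₁ × ⋯ × σₙ` of the `n`-fold direct product. -/
def tupleCell (X : CubicalCx) : (n : ℕ) → (Fin n → X.Cell) → (X.pow n).Cell
  | 0, _ => ()
  | n + 1, σ => (σ 0, X.tupleCell n (Fin.tail σ))

/-- The cubical boundary `∂ c = ∑_{i < dim c} (-1)^i (front face - back face)` of a cell. -/
noncomputable def cellBoundary (X : CubicalCx) (c : X.Cell) : X.Cell →₀ ℤ :=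
  ∑ i ∈ Finset.range (X.dim c), (-1 : ℤ) ^ i •
    (Finsupp.single (X.face true i c) (1 : ℤ) - Finsupp.single (X.face false i c) (1 : ℤ))

/-- The linear extension of `cellBoundary` to all chains. -/
noncomputable def boundary (X : CubicalCx) : (X.Cell →₀ ℤ) →ₗ[ℤ] (X.Cell →₀ ℤ) :=
  Finsupp.linearCombination ℤ X.cellBoundary

/-- The chains of degree `d`: the free abelian group on the cells of dimension `d`. -/
noncomputable def chains (X : CubicalCx) (d : ℕ) : Submodule ℤ (X.Cell →₀ ℤ) :=
  Finsupp.supported ℤ ℤ {c | X.dim c = d}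

theorem boundary_mem (X : CubicalCx) (d : ℕ) :
    ∀ x ∈ X.chains (d + 1), X.boundary x ∈ X.chains d := by
  intro x hx
  rw [boundary, Finsupp.linearCombination_apply]
  refine Submodule.sum_mem _ fun c hc => Submodule.smul_mem _ _ ?_
  have hcd : X.dim c = d + 1 := hx hc
  refine Submodule.sum_mem _ fun i hi => Submodule.smul_mem _ _ ?_
  have hi' := Finset.mem_range.1 hi
  refine Submodule.sub_mem _ (Finsupp.single_mem_supported ℤ _ ?_)
    (Finsupp.single_mem_supported ℤ _ ?_)
  · have := X.dim_face true i c hi'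
    show X.dim _ = d
    omega
  · have := X.dim_face false i c hi'
    show X.dim _ = d
    omega

theorem sum_alternating_eq_zero {M : Type*} [AddCommGroup M] (d : ℕ) (A : ℕ → ℕ → M)
    (hA : ∀ i j, j < i → i < d → A i j = A j (i - 1)) :
    ∑ i ∈ Finset.range d, ∑ j ∈ Finset.range (d - 1),
      (-1 : ℤ) ^ i • (-1 : ℤ) ^ j • A i j = 0 := by
  rw [← Finset.sum_product']
  refine Finset.sum_involution
    (fun p _ => if p.2 < p.1 then (p.2, p.1 - 1) else (p.2 + 1, p.1)) ?_ ?_ ?_ ?_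
  · rintro ⟨i, j⟩ h
    simp only [Finset.mem_product, Finset.mem_range] at h
    by_cases hji : j < i
    · simp only [hji, if_true]
      obtain ⟨m, rfl⟩ : ∃ m, i = m + 1 := ⟨i - 1, by omega⟩
      rw [hA _ _ hji h.1]
      simp only [Nat.add_sub_cancel, smul_smul, ← add_smul, pow_succ]
      convert zero_smul ℤ _ using 2
      ring
    · simp only [hji, if_false]
      rw [hA (j + 1) i (by omega) (by omega)]
      simp only [Nat.add_sub_cancel, smul_smul, ← add_smul, pow_succ]
      convert zero_smul ℤ _ using 2
      ring
  · rintro ⟨i, j⟩ h _ heq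
    simp only at heq
    split_ifs at heq with hji <;> simp only [Prod.mk.injEq] at heq <;> omega
  · rintro ⟨i, j⟩ h
    simp only [Finset.mem_product, Finset.mem_range] at h ⊢
    split_ifs with hji <;> constructor <;> simp only <;> omega
  · rintro ⟨i, j⟩ h
    by_cases hji : j < i
    · have : ¬ i - 1 < j := by omega
      simp only [hji, this, if_true, if_false]
      exact Prod.ext (Nat.sub_add_cancel (by omega)) rfl
    · have : i < j + 1 := by omega
      simp [hji, this]

theorem boundary_boundary (X : CubicalCx) (x : X.Cell →₀ ℤ) : X.boundary (X.boundary x) = 0 := by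
  suffices h : X.boundary ∘ₗ X.boundary = 0 from LinearMap.congr_fun h x
  refine Finsupp.lhom_ext' fun c => LinearMap.ext_ring ?_
  have key := sum_alternating_eq_zero (X.dim c) (fun i j =>
    (Finsupp.single (X.face true j (X.face true i c)) (1 : ℤ)
      - Finsupp.single (X.face false j (X.face true i c)) (1 : ℤ))
    - (Finsupp.single (X.face true j (X.face false i c)) (1 : ℤ)
      - Finsupp.single (X.face false j (X.face false i c)) (1 : ℤ))) (by
    intro i j hji hi
    simp only [X.face_face _ _ j i c hji hi]
    abel)
  simp only [LinearMap.comp_apply, Finsupp.lsingle_apply, LinearMap.zero_apply]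
  rw [← key, boundary, Finsupp.linearCombination_single, one_smul, cellBoundary, map_sum]
  refine Finset.sum_congr rfl fun i hi => ?_
  have hi' := Finset.mem_range.1 hi
  have h1 : X.dim (X.face true i c) = X.dim c - 1 := by
    have := X.dim_face true i c hi'; omega
  have h2 : X.dim (X.face false i c) = X.dim c - 1 := by
    have := X.dim_face false i c hi'; omega
  rw [map_smul, map_sub, Finsupp.linearCombination_single, Finsupp.linearCombination_single,
    one_smul, one_smul, cellBoundary, cellBoundary, h1, h2, ← Finset.sum_sub_distrib,
    Finset.smul_sum]
  refine Finset.sum_congr rfl fun j _ => ?_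
  rw [← smul_sub]

/-- The cubical chain complex of a cubical complex. -/
noncomputable def chainComplex (X : CubicalCx) : ChainComplex (ModuleCat.{0} ℤ) ℕ :=
  ChainComplex.of (fun d => ModuleCat.of ℤ (X.chains d))
    (fun d => ModuleCat.ofHom (X.boundary.restrict (X.boundary_mem d)))
    (fun d => by
      exact ModuleCat.hom_ext (LinearMap.ext fun x => Subtype.ext (X.boundary_boundary x.1)))

/-- A cell of dimension `d`, as a generator of the `d`-th chain group. -/
noncomputable def cellChain (X : CubicalCx) {d : ℕ} (c : X.Cell) (hc : X.dim c = d) :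
    X.chainComplex.X d :=
  (⟨Finsupp.single c 1, Finsupp.single_mem_supported ℤ _ hc⟩ : X.chains d)

end CubicalCx

/-! ### The cycle graph and vertex-edge tuples -/

/-- The vertices and edges of the cycle graph `C_k`: `Sum.inl i` is the vertex `v_i` and `Sum.inr i`
is the edge `e_i` (with end points `v_i` and `v_{i+1}`), for `i ∈ ℤ/k`. -/
abbrev CycleCell (k : ℕ) : Type := ZMod k ⊕ ZMod k

/-- The cycle graph `C_k` as a one-dimensional cubical complex, the edge `e_i` being oriented from
`v_i` to `v_{i+1}`. -/
def cycleGraphCx (k : ℕ) : CubicalCx where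
  Cell := CycleCell k
  dim c := Sum.elim (fun _ => 0) (fun _ => 1) c
  face ε _ c := Sum.elim (fun i => Sum.inl i)
    (fun i => Sum.inl (if ε = true then i + 1 else i)) c
  dim_face := by
    rintro ε i (c | c) h
    · simp at h
    · simp
  face_face := by
    rintro ε ε' i j (c | c) hij hj
    · simp at hj
    · simp only [Sum.elim_inr] at hj; omega

/-- Vertex-edge `n`-tuples of `C_k`. -/
abbrev VETuple (k n : ℕ) : Type := Fin n → CycleCell k

namespace VETuple

variable {k n : ℕ}

/-- The vertex support set. -/
def suppV [NeZero k] (σ : VETuple k n) : Finset (ZMod k) :=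
  Finset.univ.filter fun i => ∃ j, σ j = Sum.inl i

/-- The set of positions which hold an edge. -/
def edgePositions (σ : VETuple k n) : Finset (Fin n) :=
  Finset.univ.filter fun j => (σ j).isRight = true

/-- The dimension. -/
def dim (σ : VETuple k n) : ℕ := σ.edgePositions.card

/-- The number of edges in positions before `j`. -/
def rho (σ : VETuple k n) (j : Fin n) : ℕ := (σ.edgePositions.filter fun l => l < j).card

/-- The tuple `σ` with its `j`-th entry replaced by the vertex `v_a`, if `a ∈ P`; else `0`. -/
noncomputable def replaceTerm (P : Finset (ZMod k)) (σ : VETuple k n) (j : Fin n) (a : ZMod k) :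
    VETuple k n →₀ ℤ :=
  if a ∈ P then Finsupp.single (Function.update σ j (Sum.inl a)) 1 else 0

/-- The part of the boundary of `σ` in position `j`: if `σ_j = e_i`, then `e_i` is replaced by
`v_{i+1}` and, with the opposite sign, by `v_i`, whenever the index lies in `P`. -/
noncomputable def boundaryAt (P : Finset (ZMod k)) (σ : VETuple k n) (j : Fin n) :
    VETuple k n →₀ ℤ :=
  Sum.elim (fun _ => 0)
    (fun i => (-1 : ℤ) ^ σ.rho j • (σ.replaceTerm P j (i + 1) - σ.replaceTerm P j i)) (σ j)

/-- The boundary of a vertex-edge tuple. -/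
noncomputable def tupleBoundary (P : Finset (ZMod k)) (σ : VETuple k n) : VETuple k n →₀ ℤ :=
  ∑ j, σ.boundaryAt P j

/-- The linear extension of `tupleBoundary`. -/
noncomputable def boundary (n : ℕ) (P : Finset (ZMod k)) :
    (VETuple k n →₀ ℤ) →ₗ[ℤ] (VETuple k n →₀ ℤ) :=
  Finsupp.linearCombination ℤ (tupleBoundary P)

/-- The vertex-edge tuples of dimension `d` that generate the `d`-th chain group of `𝒞^{P,q}`. -/
def generators [NeZero k] (n : ℕ) (P : Finset (ZMod k)) (q d : ℕ) : Set (VETuple k n) :=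
  {σ | σ.dim = d ∧ σ.suppV ⊆ P ∧ q ≤ σ.suppV.card}

/-- The `d`-th chain group of `𝒞^{P,q}`: the free abelian group on `generators n P q d`. -/
noncomputable def chains [NeZero k] (n : ℕ) (P : Finset (ZMod k)) (q d : ℕ) :
    Submodule ℤ (VETuple k n →₀ ℤ) :=
  Finsupp.supported ℤ ℤ (generators n P q d)

theorem mem_edgePositions (σ : VETuple k n) (j : Fin n) :
    j ∈ σ.edgePositions ↔ ∃ i, σ j = Sum.inr i := by
  simp [edgePositions, Sum.isRight_iff]

theorem edgePositions_update (σ : VETuple k n) (j : Fin n) (a : ZMod k) :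
    edgePositions (Function.update σ j (Sum.inl a) : VETuple k n) = σ.edgePositions.erase j := by
  ext l
  rcases eq_or_ne l j with rfl | h
  · simp [mem_edgePositions]
  · simp [mem_edgePositions, h]

theorem replace_mem_generators [NeZero k] (P : Finset (ZMod k)) (q d : ℕ) (σ : VETuple k n)
    (hσ : σ ∈ generators n P q (d + 1)) (j : Fin n) (i a : ZMod k) (hj : σ j = Sum.inr i)
    (ha : a ∈ P) : (Function.update σ j (Sum.inl a) : VETuple k n) ∈ generators n P q d := by
  obtain ⟨h1, h2, h3⟩ := hσ
  refine ⟨?_, ?_, h3.trans (Finset.card_le_card ?_)⟩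
  · have : j ∈ σ.edgePositions := (mem_edgePositions _ _).2 ⟨i, hj⟩
    rw [dim, edgePositions_update, Finset.card_erase_of_mem this]
    rw [dim] at h1
    omega
  · intro b hb
    simp only [suppV, Finset.mem_filter, Finset.mem_univ, true_and] at hb
    obtain ⟨l, hl⟩ := hb
    rcases eq_or_ne l j with rfl | h
    · simp only [Function.update_self, Sum.inl.injEq] at hl
      exact hl ▸ ha
    · rw [Function.update_of_ne h] at hl
      exact h2 (by simpa [suppV] using ⟨l, hl⟩)
  · intro b hb
    simp only [suppV, Finset.mem_filter, Finset.mem_univ, true_and] at hb ⊢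
    obtain ⟨l, hl⟩ := hb
    have h : l ≠ j := by
      rintro rfl
      rw [hj] at hl
      cases hl
    exact ⟨l, by rw [Function.update_of_ne h, hl]⟩

theorem boundary_mem [NeZero k] (n : ℕ) (P : Finset (ZMod k)) (q d : ℕ) :
    ∀ x ∈ chains n P q (d + 1), boundary n P x ∈ chains n P q d := by
  intro x hx
  rw [boundary, Finsupp.linearCombination_apply]
  refine Submodule.sum_mem _ fun σ hσ => Submodule.smul_mem _ _ ?_
  have hg : σ ∈ generators n P q (d + 1) := hx hσ
  refine Submodule.sum_mem _ fun j _ => ?_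
  rw [boundaryAt]
  rcases h : σ j with i | i
  · exact Submodule.zero_mem _
  · have key : ∀ a, σ.replaceTerm P j a ∈ chains n P q d := by
      intro a
      rw [replaceTerm]
      split_ifs with ha
      · exact Finsupp.single_mem_supported ℤ _ (replace_mem_generators P q d σ hg j i a h ha)
      · exact Submodule.zero_mem _
    exact Submodule.smul_mem _ _ (Submodule.sub_mem _ (key _) (key _))

/-- `replaceTerm` in two positions. -/
noncomputable def replaceTerm₂ (P : Finset (ZMod k)) (σ : VETuple k n) (j l : Fin n)
    (a b : ZMod k) : VETuple k n →₀ ℤ :=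
  if a ∈ P then replaceTerm P (Function.update σ j (Sum.inl a)) l b else 0

theorem replaceTerm₂_comm (P : Finset (ZMod k)) (σ : VETuple k n) (j l : Fin n) (h : j ≠ l)
    (a b : ZMod k) : replaceTerm₂ P σ j l a b = replaceTerm₂ P σ l j b a := by
  unfold replaceTerm₂ replaceTerm
  rw [Function.update_comm h]
  split_ifs <;> rfl

theorem rho_update_of_le (σ : VETuple k n) (j l : Fin n) (h : l ≤ j) (a : ZMod k) :
    rho (Function.update σ j (Sum.inl a) : VETuple k n) l = σ.rho l := by
  unfold rho
  rw [edgePositions_update]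
  congr 1
  ext m
  simp only [Finset.mem_filter, Finset.mem_erase]
  constructor
  · rintro ⟨⟨_, h1⟩, h2⟩; exact ⟨h1, h2⟩
  · rintro ⟨h1, h2⟩; exact ⟨⟨(lt_of_lt_of_le h2 h).ne, h1⟩, h2⟩

theorem rho_update_of_lt (σ : VETuple k n) (j l : Fin n) (h : j < l) (i a : ZMod k)
    (hj : σ j = Sum.inr i) :
    rho (Function.update σ j (Sum.inl a) : VETuple k n) l + 1 = σ.rho l := by
  unfold rho
  rw [edgePositions_update, Finset.filter_erase, Finset.card_erase_add_one]
  exact Finset.mem_filter.2 ⟨(mem_edgePositions _ _).2 ⟨i, hj⟩, h⟩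

/-- The `(j, l)` part of `∂ ∂ σ`. -/
noncomputable def boundaryAt₂ (P : Finset (ZMod k)) (σ : VETuple k n) (j l : Fin n) :
    VETuple k n →₀ ℤ :=
  Sum.elim (fun _ => 0) (fun i => (-1 : ℤ) ^ σ.rho j •
    ((if i + 1 ∈ P then boundaryAt P (Function.update σ j (Sum.inl (i + 1))) l else 0)
      - (if i ∈ P then boundaryAt P (Function.update σ j (Sum.inl i)) l else 0))) (σ j)

theorem boundaryAt₂_self (P : Finset (ZMod k)) (σ : VETuple k n) (j : Fin n) :
    boundaryAt₂ P σ j j = 0 := by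
  unfold boundaryAt₂ boundaryAt
  rcases σ j with i | i <;> simp

theorem boundaryAt₂_lt (P : Finset (ZMod k)) (σ : VETuple k n) (j l : Fin n) (h : j < l) :
    boundaryAt₂ P σ j l = - boundaryAt₂ P σ l j := by
  unfold boundaryAt₂ boundaryAt
  simp only [Function.update_of_ne h.ne']
  rcases hj : σ j with i | i <;> rcases hl : σ l with i' | i' <;>
    simp only [Sum.elim_inl, Sum.elim_inr, ite_self, sub_zero, smul_zero, neg_zero,
      Function.update_of_ne h.ne, hj]
  have e1' : ∀ a, (-1 : ℤ) ^ rho (Function.update σ j (Sum.inl a) : VETuple k n) l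
      = - (-1 : ℤ) ^ σ.rho l := by
    intro a
    rw [← rho_update_of_lt σ j l h i a hj, pow_succ]; ring
  have split : ∀ (p : Prop) [Decidable p] (x : ℤ) (A B : VETuple k n →₀ ℤ),
      (if p then x • (A - B) else 0)
        = x • ((if p then A else 0) - (if p then B else 0)) := by
    intro p _ x A B
    split_ifs <;> simp
  have fold : ∀ (j l : Fin n) (a b : ZMod k),
      (if a ∈ P then replaceTerm P (Function.update σ j (Sum.inl a)) l b else 0)
        = replaceTerm₂ P σ j l a b := fun _ _ _ _ => rfl
  simp only [e1', rho_update_of_le σ l j h.le, split, fold, replaceTerm₂_comm P σ l j h.ne']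
  module

theorem boundary_boundary (n : ℕ) (P : Finset (ZMod k)) (x : VETuple k n →₀ ℤ) :
    boundary n P (boundary n P x) = 0 := by
  suffices h : boundary n P ∘ₗ boundary n P = 0 from LinearMap.congr_fun h x
  refine Finsupp.lhom_ext' fun σ => LinearMap.ext_ring ?_
  have e : boundary n P (boundary n P (Finsupp.single σ 1)) = ∑ j, ∑ l, boundaryAt₂ P σ j l := by
    have e0 : ∀ τ : VETuple k n, boundary n P (Finsupp.single τ 1) = ∑ l, boundaryAt P τ l := by
      intro τ
      rw [boundary, Finsupp.linearCombination_single, one_smul, tupleBoundary]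
    rw [e0, map_sum]
    refine Finset.sum_congr rfl fun j _ => ?_
    unfold boundaryAt₂
    conv_lhs => unfold boundaryAt
    rcases σ j with i | i
    · simp
    · simp only [Sum.elim_inr, map_smul, map_sub, ← Finset.smul_sum, Finset.sum_sub_distrib]
      unfold replaceTerm
      split_ifs <;> simp [e0]
  have anti : ∀ j l, boundaryAt₂ P σ j l = - boundaryAt₂ P σ l j := by
    intro j l
    rcases lt_trichotomy j l with h | rfl | h
    · exact boundaryAt₂_lt P σ j l h
    · rw [boundaryAt₂_self, neg_zero]
    · rw [boundaryAt₂_lt P σ l j h, neg_neg]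
  have s : (∑ j, ∑ l, boundaryAt₂ P σ j l) = - ∑ j, ∑ l, boundaryAt₂ P σ j l := by
    conv_lhs => rw [Finset.sum_comm]
    rw [← Finset.sum_neg_distrib]
    refine Finset.sum_congr rfl fun j _ => ?_
    rw [← Finset.sum_neg_distrib]
    exact Finset.sum_congr rfl fun l _ => anti l j
  simp only [LinearMap.comp_apply, Finsupp.lsingle_apply, LinearMap.zero_apply]
  rw [e]
  exact self_eq_neg.1 s

end VETuple

/-- The chain complex `𝒞^{P,q}` (for `n`-tuples). -/
noncomputable def anchoredComplex {k : ℕ} [NeZero k] (n : ℕ) (P : Finset (ZMod k)) (q : ℕ) :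
    ChainComplex (ModuleCat.{0} ℤ) ℕ :=
  ChainComplex.of (fun d => ModuleCat.of ℤ (VETuple.chains n P q d))
    (fun d => ModuleCat.ofHom ((VETuple.boundary n P).restrict (VETuple.boundary_mem n P q d)))
    (fun d => by
      exact ModuleCat.hom_ext (LinearMap.ext fun x =>
        Subtype.ext (VETuple.boundary_boundary n P x.1)))

/-- A generating vertex-edge tuple, as an element of the chain group of `𝒞^{P,q}`. -/
noncomputable def tupleChain {k n : ℕ} [NeZero k] (P : Finset (ZMod k)) (q : ℕ) {d : ℕ}
    (σ : VETuple k n) (hσ : σ ∈ VETuple.generators n P q d) : (anchoredComplex n P q).X d :=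
  (⟨Finsupp.single σ 1, Finsupp.single_mem_supported ℤ _ hσ⟩ : VETuple.chains n P q d)

/-- The `i`-th integral singular homology group of a topological space. -/
noncomputable def singularHomologyZ (X : Type) [TopologicalSpace X] (i : ℕ) : ModuleCat.{0} ℤ :=
  ((AlgebraicTopology.singularHomologyFunctor (ModuleCat.{0} ℤ) i).obj (ModuleCat.of ℤ ℤ)).obj
    (TopCat.of X)

open CategoryTheory Limits AlgebraicTopology Simplicial
open scoped TensorProduct

/-! The complex is an `n`-fold tensor power. For one position, `𝒞^{P,0}` is the cellular complex of
`C_k` relative to the vertices outside `P`. Adding a first entry to a tuple obeys the Leibniz rule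
with the Koszul sign (`tupleBoundary_cons`), so the complex of `n`-tuples is the tensor power of
that small complex. The same rule governs the cubical boundary of a product, which gives the
isomorphism with the cubical complex of `C_k × ⋯ × C_k`.

The small complex contracts explicitly onto its homology. If `P` is everything, contracting the path
of edges from `v_0` once round to `v_{-1}` leaves one class in degree 0 and one in degree 1
(`fullContraction`). If `P` is proper, each vertex of `P` is cancelled by the arc running from it to
the next vertex outside `P`; what survives is one class in degree 1 for each vertex outside `P`
(`properContraction`). Contractions can be tensored (`GradedContraction.tensor`), so no Künneth
theorem is needed: the homology of the tensor power is free on `n`-tuples of classes, graded by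
total degree. Counting them gives rank `n.choose i` in the full case, and `h ^ n` concentrated in
degree `n` in the proper case.

On the topological side, the covering `X × ℝ → X × ℝ/ℤ` with deck translation `T` gives a short
exact sequence of singular chains `0 → C(X × ℝ) → C(X × ℝ) → C(X × ℝ/ℤ) → 0`, whose first map is `1
- T`. Since `T` is homotopic to the identity, `1 - T` vanishes on homology and the long exact
sequence breaks into short ones. Pascal's rule then shows that the homology of the torus is free of
rank `n.choose i` (`singularHomologyZ_torus`). The isomorphism with singular homology is obtained by
comparing ranks of free modules. -/

/-! ### Free `ℤ`-actions and the exact sequence of free abelian groups they induce -/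

theorem Finsupp.injective_id_sub_lmapDomain {S : Type*} (t : S ≃ S)
    (free : ∀ x (m : ℤ), (t ^ m) x = x → m = 0) :
    Function.Injective (LinearMap.id - Finsupp.lmapDomain ℤ ℤ t : (S →₀ ℤ) →ₗ[ℤ] (S →₀ ℤ)) := by
  rw [← LinearMap.ker_eq_bot, LinearMap.ker_eq_bot']
  intro x hx
  have h1 : ∀ s, x (t s) = x s := by
    intro s
    have h := DFunLike.congr_fun (sub_eq_zero.1 hx) (t s)
    rw [LinearMap.id_apply, Finsupp.lmapDomain_apply, Finsupp.mapDomain_apply t.injective] at h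
    exact h
  have h2 : ∀ (m : ℤ) s, x ((t ^ m) s) = x s := by
    intro m
    induction m with
    | zero => intro s; rfl
    | succ m ih => intro s; rw [zpow_add_one, Equiv.Perm.mul_apply, ih, h1]
    | pred m ih =>
      intro s
      rw [zpow_sub_one, Equiv.Perm.mul_apply, ih, ← h1, show t (t⁻¹ s) = s from t.apply_symm_apply s]
  -- An invariant chain is constant on orbits. Orbits are infinite by freeness, while supports are
  -- finite, so the chain is zero.
  ext s
  by_contra hs
  refine Set.infinite_of_injective_forall_mem (f := fun m : ℤ => (t ^ m) s) ?_
    (fun m => ?_) x.support.finite_toSet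
  · intro m m' h
    have := free s (-m' + m) (by
      rw [zpow_add, Equiv.Perm.mul_apply, show (t ^ m) s = (t ^ m') s from h,
        ← Equiv.Perm.mul_apply, ← zpow_add]; simp)
    omega
  · simpa [h2] using hs

theorem Finsupp.ker_lmapDomain_le_range {S Q : Type*} (t : S ≃ S) (π : S → Q)
    (hπ : Function.Surjective π) (fib : ∀ x y, π x = π y → ∃ m : ℤ, (t ^ m) x = y) :
    LinearMap.ker (Finsupp.lmapDomain ℤ ℤ π) ≤
      LinearMap.range (LinearMap.id - Finsupp.lmapDomain ℤ ℤ t : (S →₀ ℤ) →ₗ[ℤ] (S →₀ ℤ)) := by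
  set r := LinearMap.range (LinearMap.id - Finsupp.lmapDomain ℤ ℤ t : (S →₀ ℤ) →ₗ[ℤ] (S →₀ ℤ))
  have h1 : ∀ s, single s (1 : ℤ) - single (t s) 1 ∈ r := fun s =>
    ⟨single s 1, by simp⟩
  have h2 : ∀ (m : ℤ) s, single s (1 : ℤ) - single ((t ^ m) s) 1 ∈ r := by
    intro m
    induction m with
    | zero => intro s; simp
    | succ m ih =>
      intro s
      rw [zpow_add_one, Equiv.Perm.mul_apply]
      simpa using r.add_mem (h1 s) (ih (t s))
    | pred m ih =>
      intro s
      rw [zpow_sub_one, Equiv.Perm.mul_apply]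
      have := h1 (t⁻¹ s)
      rw [show t (t⁻¹ s) = s from t.apply_symm_apply s] at this
      simpa using r.sub_mem (ih (t⁻¹ s)) this
  obtain ⟨σ, hσ⟩ := hπ.hasRightInverse
  -- Modulo the range every point equals the chosen representative `σ (π s)` of its orbit, so a
  -- chain is determined there by its image under `π`.
  have h3 : ∀ x : S →₀ ℤ, x - Finsupp.lmapDomain ℤ ℤ σ (Finsupp.lmapDomain ℤ ℤ π x) ∈ r := by
    intro x
    induction x using Finsupp.induction_linear with
    | zero => simp
    | add a b ha hb =>
      rw [map_add, map_add, add_sub_add_comm]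
      exact r.add_mem ha hb
    | single s c =>
      obtain ⟨m, hm⟩ := fib s (σ (π s)) (hσ _).symm
      have := r.smul_mem c (h2 m s)
      rw [hm] at this
      simpa [smul_sub] using this
  intro x hx
  have := h3 x
  rwa [LinearMap.mem_ker.1 hx, map_zero, sub_zero] at this

noncomputable def sigmaConstIntIso (S : Type) :
    (sigmaConst.obj (ModuleCat.of ℤ ℤ)).obj S ≅ ModuleCat.of ℤ (S →₀ ℤ) where
  hom := Sigma.desc fun s => ModuleCat.ofHom (Finsupp.lsingle s)
  inv := ModuleCat.ofHom (Finsupp.linearCombination ℤ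
    fun s => (Sigma.ι (fun _ : S => ModuleCat.of ℤ ℤ) s).hom (1 : ℤ))
  hom_inv_id := by
    refine Sigma.hom_ext _ _ fun s => ?_
    rw [Sigma.ι_desc_assoc]
    ext
    simp only [ModuleCat.hom_comp, ModuleCat.hom_ofHom, LinearMap.comp_apply,
      Finsupp.lsingle_apply, Finsupp.linearCombination_single]
    exact @one_smul _ _ _ (_) _
  inv_hom_id := by
    ext s : 3
    simp

theorem sigmaConstIntIso_hom_naturality {S T : Type} (f : S → T) :
    (sigmaConst.obj (ModuleCat.of ℤ ℤ)).map (↾f) ≫ (sigmaConstIntIso T).hom =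
      (sigmaConstIntIso S).hom ≫ ModuleCat.ofHom (Finsupp.lmapDomain ℤ ℤ f) := by
  refine Sigma.hom_ext _ _ fun s => ?_
  simp [sigmaConstIntIso]
  ext
  simp

/-- The form of `0 → ℤ[S] → ℤ[S] → ℤ[Q] → 0` that applies to singular chains, whose groups are
coproducts of copies of `ℤ` indexed by simplices. Here `Q` is the orbit set of the free action
generated by `t`. -/
theorem sigmaConst_int_shortExact {S Q : Type} (t : S ≃ S) (π : S → Q)
    (hπ : Function.Surjective π) (fib : ∀ x y, π x = π y → ∃ m : ℤ, (t ^ m) x = y)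
    (free : ∀ x (m : ℤ), (t ^ m) x = x → m = 0)
    (w : (𝟙 _ - (sigmaConst.obj (ModuleCat.of ℤ ℤ)).map (↾t)) ≫
      (sigmaConst.obj (ModuleCat.of ℤ ℤ)).map (↾π) = 0) :
    (ShortComplex.mk _ _ w).ShortExact := by
  have nat : (𝟙 _ - (sigmaConst.obj (ModuleCat.of ℤ ℤ)).map (↾t)) ≫ (sigmaConstIntIso S).hom =
      (sigmaConstIntIso S).hom ≫
        ModuleCat.ofHom (LinearMap.id - Finsupp.lmapDomain ℤ ℤ t) := by
    rw [Preadditive.sub_comp, sigmaConstIntIso_hom_naturality]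
    change _ = (sigmaConstIntIso S).hom ≫ (𝟙 _ - ModuleCat.ofHom (Finsupp.lmapDomain ℤ ℤ t))
    rw [Preadditive.comp_sub, Category.id_comp, Category.comp_id]
  have w' : ModuleCat.ofHom (LinearMap.id - Finsupp.lmapDomain ℤ ℤ t) ≫
      ModuleCat.ofHom (Finsupp.lmapDomain ℤ ℤ π) = 0 := by
    rw [← cancel_epi (sigmaConstIntIso S).hom, comp_zero,
      ← zero_comp (f := (sigmaConstIntIso Q).hom), ← w, ← reassoc_of% nat, Category.assoc,
      sigmaConstIntIso_hom_naturality]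
  have e : ShortComplex.mk _ _ w ≅ ShortComplex.mk _ _ w' :=
    ShortComplex.isoMk (sigmaConstIntIso S) (sigmaConstIntIso S) (sigmaConstIntIso Q) nat.symm
      (sigmaConstIntIso_hom_naturality π).symm
  refine ShortComplex.shortExact_of_iso e.symm ?_
  refine ModuleCat.shortComplex_shortExact _ ?_
    (Finsupp.injective_id_sub_lmapDomain t free) (Finsupp.mapDomain_surjective hπ)
  rw [LinearMap.exact_iff]
  refine le_antisymm (Finsupp.ker_lmapDomain_le_range t π hπ fib) ?_
  rintro _ ⟨x, rfl⟩
  exact congr(ModuleCat.Hom.hom $w' x)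

/-! ### Singular chains of the covering `X × ℝ → X × ℝ/ℤ` -/

noncomputable abbrev singularChainComplexZ (X : TopCat.{0}) : ChainComplex (ModuleCat.{0} ℤ) ℕ :=
  ((singularChainComplexFunctor (ModuleCat.{0} ℤ)).obj (ModuleCat.of ℤ ℤ)).obj X

noncomputable abbrev singularChainMapZ {X Y : TopCat.{0}} (f : X ⟶ Y) :
    singularChainComplexZ X ⟶ singularChainComplexZ Y :=
  ((singularChainComplexFunctor (ModuleCat.{0} ℤ)).obj (ModuleCat.of ℤ ℤ)).map f

theorem TopCat.toSSetObjEquiv_map {X Y : TopCat.{0}} (f : X ⟶ Y) (d : ℕ)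
    (s : (TopCat.toSSet.obj X).obj (.op ⦋d⦌)) :
    TopCat.toSSetObjEquiv Y _ ((TopCat.toSSet.map f).app (.op ⦋d⦌) s) =
      f.hom.comp (TopCat.toSSetObjEquiv X _ s) := rfl

/-- Reversing a contraction of `A` gives a homotopy from a constant map to `f`. The constant map
lifts, hence so does the homotopy, and its end at time 1 lifts `f`. -/
theorem IsCoveringMap.exists_lift_of_contractible {A E X : Type*} [TopologicalSpace A]
    [TopologicalSpace E] [TopologicalSpace X] [ContractibleSpace A] {p : E → X}
    (cov : IsCoveringMap p) (hp : Function.Surjective p) (f : C(A, X)) :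
    ∃ g : C(A, E), ∀ a, p (g a) = f a := by
  obtain ⟨a, ⟨H⟩⟩ := id_nullhomotopic A
  obtain ⟨e, he⟩ := hp (f a)
  let H' : C(unitInterval × A, X) := f.comp H.symm.toContinuousMap
  have H0 : ∀ a, H' (0, a) = p (ContinuousMap.const A e a) := by
    intro b
    simp [H', he]
  refine ⟨(cov.liftHomotopy H' (.const A e) H0).comp ((ContinuousMap.const A 1).prodMk (.id A)),
    fun b => ?_⟩
  refine (congr_fun (cov.liftHomotopy_lifts H' (.const A e) H0) (1, b)).trans ?_
  change f (H.symm (1, b)) = f b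
  rw [H.symm.apply_one, ContinuousMap.id_apply]

instance stdSimplex.contractibleSpace (d : ℕ) : ContractibleSpace (stdSimplex ℝ (Fin (d + 1))) :=
  (convex_stdSimplex ℝ _).contractibleSpace (Set.nonempty_coe_sort.1 inferInstance)

/-- The integer is `h a - g a` at one point `a`. Then `g + m` and `h` are lifts of the same map that
agree at `a`, so they agree on the connected space `A`. -/
theorem UnitAddCircle.exists_int_of_lifts {A : Type*} [TopologicalSpace A] [ConnectedSpace A]
    (g h : C(A, ℝ)) (H : ∀ a, (g a : UnitAddCircle) = h a) : ∃ m : ℤ, ∀ a, g a + m = h a := by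
  obtain ⟨a⟩ := (inferInstance : Nonempty A)
  obtain ⟨m, hm⟩ := (AddCircle.coe_eq_zero_iff (1 : ℝ)).1
    ((AddCircle.coe_sub _ _ _).trans (sub_eq_zero.2 (H a).symm))
  refine ⟨m, congr_fun ((AddCircle.isCoveringMap_coe (1 : ℝ)).eq_of_comp_eq (by fun_prop)
    h.continuous (funext fun b => ?_) a ?_)⟩
  · refine Eq.trans ?_ (H b)
    change ((g b + m : ℝ) : UnitAddCircle) = _
    rw [AddCircle.coe_add, (AddCircle.coe_eq_zero_iff (1 : ℝ)).2 ⟨m, zsmul_one m⟩]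
    exact add_zero _
  · rw [zsmul_eq_mul, mul_one] at hm
    rw [hm]; ring

section CircleCover

variable (X : Type) [TopologicalSpace X]

/-- The translation of the second factor of `X × ℝ` by `c`. -/
noncomputable def lineTranslation (c : ℝ) : TopCat.of (X × ℝ) ⟶ TopCat.of (X × ℝ) :=
  TopCat.ofHom ⟨fun p => (p.1, p.2 + c), by fun_prop⟩

/-- The covering `X × ℝ → X × ℝ/ℤ`. -/
noncomputable def circleCover : TopCat.of (X × ℝ) ⟶ TopCat.of (X × UnitAddCircle) :=
  TopCat.ofHom ⟨fun p => (p.1, (p.2 : UnitAddCircle)),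
    continuous_fst.prodMk ((AddCircle.continuous_mk' 1).comp continuous_snd)⟩

theorem lineTranslation_comp (a b : ℝ) :
    lineTranslation X a ≫ lineTranslation X b = lineTranslation X (a + b) := by
  ext x
  · rfl
  · exact add_assoc _ _ _

theorem lineTranslation_zero : lineTranslation X 0 = 𝟙 _ := by
  ext x
  · rfl
  · exact add_zero _

theorem lineTranslation_comp_circleCover :
    lineTranslation X 1 ≫ circleCover X = circleCover X := by
  ext x
  · rfl
  change ((x.2 + 1 : ℝ) : UnitAddCircle) = _
  rw [AddCircle.coe_add, AddCircle.coe_period, add_zero]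
  rfl

noncomputable def lineTranslationHomotopy (c : ℝ) :
    TopCat.Homotopy (lineTranslation X c) (𝟙 _) where
  toFun q := (q.2.1, q.2.2 + (1 - (q.1 : ℝ)) * c)
  continuous_toFun := by fun_prop
  map_zero_left p := by
    refine Prod.ext rfl ?_
    change p.2 + (1 - ((0 : unitInterval) : ℝ)) * c = p.2 + c
    simp
  map_one_left p := by
    refine Prod.ext rfl ?_
    change p.2 + (1 - ((1 : unitInterval) : ℝ)) * c = p.2
    simp

noncomputable def deckPerm (d : ℕ) :
    (TopCat.toSSet.obj (TopCat.of (X × ℝ))).obj (.op ⦋d⦌) ≃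
      (TopCat.toSSet.obj (TopCat.of (X × ℝ))).obj (.op ⦋d⦌) where
  toFun s := (TopCat.toSSet.map (lineTranslation X 1)).app (.op ⦋d⦌) s
  invFun s := (TopCat.toSSet.map (lineTranslation X (-1))).app (.op ⦋d⦌) s
  left_inv s := by
    dsimp only
    rw [← NatTrans.comp_app_apply, ← Functor.map_comp, lineTranslation_comp]
    simp [lineTranslation_zero]
  right_inv s := by
    dsimp only
    rw [← NatTrans.comp_app_apply, ← Functor.map_comp, lineTranslation_comp]
    simp [lineTranslation_zero]

theorem deckPerm_zpow (d : ℕ) (m : ℤ) (s : (TopCat.toSSet.obj (TopCat.of (X × ℝ))).obj (.op ⦋d⦌)) :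
    (deckPerm X d ^ m) s = (TopCat.toSSet.map (lineTranslation X m)).app (.op ⦋d⦌) s := by
  induction m generalizing s with
  | zero => simp [lineTranslation_zero]
  | succ m ih =>
    rw [zpow_add_one, Equiv.Perm.mul_apply, ih]
    change (TopCat.toSSet.map _).app _ ((TopCat.toSSet.map _).app _ _) = _
    rw [← NatTrans.comp_app_apply, ← Functor.map_comp, lineTranslation_comp]
    congr 5
    push_cast; ring
  | pred m ih =>
    rw [zpow_sub_one, Equiv.Perm.mul_apply, ih]
    change (TopCat.toSSet.map _).app _ ((TopCat.toSSet.map _).app _ _) = _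
    rw [← NatTrans.comp_app_apply, ← Functor.map_comp, lineTranslation_comp]
    congr 5
    push_cast; ring

theorem circleCover_w : (𝟙 _ - singularChainMapZ (lineTranslation X 1)) ≫
    singularChainMapZ (circleCover X) = 0 := by
  rw [Preadditive.sub_comp, Category.id_comp, ← Functor.map_comp,
    lineTranslation_comp_circleCover, sub_self]

/-- Checked degree by degree, with `ℤ` acting on simplices by deck translations. Simplices lift
because the standard simplex is contractible, two lifts differ by an integer translation because it
is connected, and a nonzero translation fixes no simplex. -/
theorem circleCover_shortExact : (ShortComplex.mk _ _ (circleCover_w X)).ShortExact := by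
  refine HomologicalComplex.shortExact_of_degreewise_shortExact _ fun d => ?_
  refine sigmaConst_int_shortExact (deckPerm X d)
    (fun s => (TopCat.toSSet.map (circleCover X)).app (.op ⦋d⦌) s) ?_ ?_ ?_
    (congr(($(circleCover_w X)).f d))
  · intro s
    let f := TopCat.toSSetObjEquiv _ _ s
    obtain ⟨g, hg⟩ := (AddCircle.isCoveringMap_coe (1 : ℝ)).exists_lift_of_contractible
      (QuotientAddGroup.mk_surjective) ((ContinuousMap.snd).comp f)
    refine ⟨(TopCat.toSSetObjEquiv (TopCat.of (X × ℝ)) (.op ⦋d⦌)).symm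
      (((ContinuousMap.fst).comp f).prodMk g), ?_⟩
    refine (TopCat.toSSetObjEquiv _ _).injective ?_
    dsimp only
    rw [TopCat.toSSetObjEquiv_map, Equiv.apply_symm_apply]
    ext a
    · rfl
    · exact hg a
  · intro s s' h
    have h' := congr(TopCat.toSSetObjEquiv _ _ $h)
    dsimp only at h'
    rw [TopCat.toSSetObjEquiv_map, TopCat.toSSetObjEquiv_map] at h'
    obtain ⟨m, hm⟩ := UnitAddCircle.exists_int_of_lifts
      ((ContinuousMap.snd).comp (TopCat.toSSetObjEquiv (TopCat.of (X × ℝ)) _ s))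
      ((ContinuousMap.snd).comp (TopCat.toSSetObjEquiv (TopCat.of (X × ℝ)) _ s'))
      (fun a => congr(($h' a).2))
    refine ⟨m, ?_⟩
    rw [deckPerm_zpow]
    refine (TopCat.toSSetObjEquiv _ _).injective ?_
    rw [TopCat.toSSetObjEquiv_map]
    ext a
    · exact congr(($h' a).1)
    · exact hm a
  · intro s m h
    rw [deckPerm_zpow] at h
    have h' := congr(TopCat.toSSetObjEquiv _ _ $h)
    rw [TopCat.toSSetObjEquiv_map] at h'
    have a : stdSimplex ℝ (Fin (d + 1)) := Classical.arbitrary _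
    have h2 : (TopCat.toSSetObjEquiv _ _ s a).2 + (m : ℝ) = (TopCat.toSSetObjEquiv _ _ s a).2 :=
      congr(($h' a).2)
    simpa using h2

end CircleCover

/-! ### Long exact sequences whose first map vanishes on homology -/

theorem nonempty_linearEquiv_of_exact {R A B C : Type*} [CommRing R] [AddCommGroup A] [Module R A]
    [AddCommGroup B] [Module R B] [AddCommGroup C] [Module R C] {a c : ℕ}
    (eA : A ≃ₗ[R] (Fin a → R)) (eC : C ≃ₗ[R] (Fin c → R))
    (f : A →ₗ[R] B) (g : B →ₗ[R] C) (hf : Function.Injective f) (hg : Function.Surjective g)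
    (h : LinearMap.range f = LinearMap.ker g) : Nonempty (B ≃ₗ[R] (Fin (a + c) → R)) := by
  have : Module.Free R C := Module.Free.of_equiv eC.symm
  obtain ⟨s, hs⟩ := Module.projective_lifting_property g LinearMap.id hg
  exact ⟨(lequivProdOfRightSplitExact hf h hs).symm ≪≫ₗ (eA.prodCongr eC) ≪≫ₗ
    (LinearEquiv.sumArrowLequivProdArrow (Fin a) (Fin c) R R).symm ≪≫ₗ
    LinearEquiv.funCongrLeft R R finSumFinEquiv.symm⟩

namespace CategoryTheory.ShortComplex.ShortExact

variable {S : ShortComplex (ChainComplex (ModuleCat.{0} ℤ) ℕ)} (hS : S.ShortExact)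
include hS

/-- In degree 0 the map induced by `g` is onto because there is no lower degree to receive a
connecting map; it is injective because `f` induces zero. -/
theorem homology_zero_equiv (h : HomologicalComplex.homologyMap S.f 0 = 0) :
    Nonempty (S.X₂.homology 0 ≃ₗ[ℤ] S.X₃.homology 0) := by
  have := hS.epi_g
  have : Epi (HomologicalComplex.homologyMap S.g 0) :=
    HomologicalComplex.epi_homologyMap_of_epi_of_not_rel _ _ (by simp)
  have : Mono (HomologicalComplex.homologyMap S.g 0) :=
    (hS.homology_exact₂ 0).mono_g h
  have := isIso_of_mono_of_epi (HomologicalComplex.homologyMap S.g 0)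
  exact ⟨(asIso (HomologicalComplex.homologyMap S.g 0)).toLinearEquiv⟩

/-- The vanishing in degrees `i + 1` and `i` cuts out `0 → H_{i+1}(X₂) → H_{i+1}(X₃) → H_i(X₁) → 0`,
which splits since the right-hand term is free. -/
theorem homology_succ_equiv (i : ℕ) (h : HomologicalComplex.homologyMap S.f i = 0)
    (h' : HomologicalComplex.homologyMap S.f (i + 1) = 0) {a c : ℕ}
    (eA : S.X₂.homology (i + 1) ≃ₗ[ℤ] (Fin a → ℤ)) (eC : S.X₁.homology i ≃ₗ[ℤ] (Fin c → ℤ)) :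
    Nonempty (S.X₃.homology (i + 1) ≃ₗ[ℤ] (Fin (a + c) → ℤ)) := by
  have : Mono (HomologicalComplex.homologyMap S.g (i + 1)) :=
    (hS.homology_exact₂ (i + 1)).mono_g h'
  have : Epi (hS.δ (i + 1) i (by simp)) :=
    (hS.homology_exact₁ (i + 1) i (by simp)).epi_f h
  exact nonempty_linearEquiv_of_exact eA eC (HomologicalComplex.homologyMap S.g (i + 1)).hom
    (hS.δ (i + 1) i _).hom ((ModuleCat.mono_iff_injective _).1 inferInstance)
    ((ModuleCat.epi_iff_surjective _).1 inferInstance)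
    ((hS.homology_exact₃ (i + 1) i (by simp)).moduleCat_range_eq_ker)

end CategoryTheory.ShortComplex.ShortExact

/-! ### Singular homology of `X × ℝ/ℤ` and of the torus -/

/-- Homotopy equivalent spaces have isomorphic singular homology. -/
theorem singularHomologyZ_equiv {X Y : TopCat.{0}} (f : X ⟶ Y) (g : Y ⟶ X)
    (hfg : TopCat.Homotopy (f ≫ g) (𝟙 X)) (hgf : TopCat.Homotopy (g ≫ f) (𝟙 Y)) (i : ℕ) :
    Nonempty ((singularChainComplexZ X).homology i ≃ₗ[ℤ] (singularChainComplexZ Y).homology i) := by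
  have h1 := hfg.congr_homologyMap_singularChainComplexFunctor (ModuleCat.of ℤ ℤ) i
  have h2 := hgf.congr_homologyMap_singularChainComplexFunctor (ModuleCat.of ℤ ℤ) i
  rw [Functor.map_comp, HomologicalComplex.homologyMap_comp, CategoryTheory.Functor.map_id,
    HomologicalComplex.homologyMap_id] at h1 h2
  let e : (singularChainComplexZ X).homology i ≅ (singularChainComplexZ Y).homology i :=
    ⟨HomologicalComplex.homologyMap (singularChainMapZ f) i,
      HomologicalComplex.homologyMap (singularChainMapZ g) i, h1, h2⟩
  exact ⟨e.toLinearEquiv⟩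

noncomputable def lineSection (X : Type) [TopologicalSpace X] : TopCat.of X ⟶ TopCat.of (X × ℝ) :=
  TopCat.ofHom ⟨fun x => (x, 0), by fun_prop⟩

noncomputable def lineProjection (X : Type) [TopologicalSpace X] :
    TopCat.of (X × ℝ) ⟶ TopCat.of X :=
  TopCat.ofHom ⟨fun p => p.1, by fun_prop⟩

noncomputable def lineContraction (X : Type) [TopologicalSpace X] :
    TopCat.Homotopy (lineProjection X ≫ lineSection X) (𝟙 _) where
  toFun q := (q.2.1, (q.1 : ℝ) * q.2.2)
  continuous_toFun := by fun_prop
  map_zero_left p := by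
    refine Prod.ext rfl ?_
    change ((0 : unitInterval) : ℝ) * p.2 = 0
    simp
  map_one_left p := by
    refine Prod.ext rfl ?_
    change ((1 : unitInterval) : ℝ) * p.2 = p.2
    simp

theorem singularHomologyZ_prod_line (X : Type) [TopologicalSpace X] (i : ℕ) :
    Nonempty (singularHomologyZ X i ≃ₗ[ℤ] (singularChainComplexZ (TopCat.of (X × ℝ))).homology i) :=
  singularHomologyZ_equiv (lineSection X) (lineProjection X)
    (ContinuousMap.Homotopy.refl _) (lineContraction X) i

theorem singularHomologyZ_congr {X Y : Type} [TopologicalSpace X] [TopologicalSpace Y] (e : X ≃ₜ Y)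
    (i : ℕ) : Nonempty (singularHomologyZ X i ≃ₗ[ℤ] singularHomologyZ Y i) :=
  ⟨((singularChainComplexFunctor (ModuleCat.{0} ℤ)).obj (ModuleCat.of ℤ ℤ) ⋙
    HomologicalComplex.homologyFunctor _ _ i).mapIso (TopCat.isoOfHomeo (X := TopCat.of X)
      (Y := TopCat.of Y) e) |>.toLinearEquiv⟩

/-- Sliding along the line makes the translation homotopic to the identity. -/
theorem homologyMap_id_sub_lineTranslation (X : Type) [TopologicalSpace X] (i : ℕ) :
    HomologicalComplex.homologyMap (𝟙 _ - singularChainMapZ (lineTranslation X 1)) i = 0 := by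
  rw [HomologicalComplex.homologyMap_sub,
    (lineTranslationHomotopy X 1).congr_homologyMap_singularChainComplexFunctor,
    CategoryTheory.Functor.map_id, sub_self]

theorem singularHomologyZ_prod_circle_zero (X : Type) [TopologicalSpace X] :
    Nonempty (singularHomologyZ X 0 ≃ₗ[ℤ] singularHomologyZ (X × UnitAddCircle) 0) := by
  obtain ⟨e⟩ := singularHomologyZ_prod_line X 0
  obtain ⟨e'⟩ := (circleCover_shortExact X).homology_zero_equiv
    (homologyMap_id_sub_lineTranslation X 0)
  exact ⟨e ≪≫ₗ e'⟩

theorem singularHomologyZ_prod_circle_succ (X : Type) [TopologicalSpace X] (i : ℕ) {a c : ℕ}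
    (eA : singularHomologyZ X (i + 1) ≃ₗ[ℤ] (Fin a → ℤ))
    (eC : singularHomologyZ X i ≃ₗ[ℤ] (Fin c → ℤ)) :
    Nonempty (singularHomologyZ (X × UnitAddCircle) (i + 1) ≃ₗ[ℤ] (Fin (a + c) → ℤ)) := by
  obtain ⟨e⟩ := singularHomologyZ_prod_line X (i + 1)
  obtain ⟨e'⟩ := singularHomologyZ_prod_line X i
  exact (circleCover_shortExact X).homology_succ_equiv i
    (homologyMap_id_sub_lineTranslation X i) (homologyMap_id_sub_lineTranslation X (i + 1))
    (e.symm ≪≫ₗ eA) (e'.symm ≪≫ₗ eC)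

def unitAddTorusSucc (n : ℕ) : UnitAddTorus (Fin n) × UnitAddCircle ≃ₜ UnitAddTorus (Fin (n + 1)) where
  toFun p := Fin.cons p.2 p.1
  invFun x := (fun j => x j.succ, x 0)
  left_inv _ := rfl
  right_inv x := Fin.cons_self_tail x
  continuous_toFun := by
    refine continuous_pi fun j => ?_
    refine Fin.cases ?_ (fun j => ?_) j
    · exact continuous_snd
    · exact (continuous_apply j).comp continuous_fst
  continuous_invFun := by fun_prop

/-- Induction on the number of circle factors, starting from a point; ranks add according to
Pascal's rule. -/
theorem singularHomologyZ_torus (n i : ℕ) :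
    Nonempty (singularHomologyZ (UnitAddTorus (Fin n)) i ≃ₗ[ℤ] (Fin (n.choose i) → ℤ)) := by
  induction n generalizing i with
  | zero =>
    rcases i with _ | i
    · let e := singularHomologyFunctorZeroOfTotallyDisconnectedSpace (ModuleCat.{0} ℤ)
        (ModuleCat.of ℤ ℤ) (TopCat.of (UnitAddTorus (Fin 0))) ≪≫ sigmaConstIntIso _
      exact ⟨e.toLinearEquiv ≪≫ₗ Finsupp.uniqueLinearEquiv ℤ ℤ (default : UnitAddTorus (Fin 0)) ≪≫ₗ
        (LinearEquiv.funUnique (Fin 1) ℤ ℤ).symm⟩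
    · have := ModuleCat.subsingleton_of_isZero
        (isZero_singularHomologyFunctor_of_totallyDisconnectedSpace (ModuleCat.{0} ℤ) (i + 1)
          (ModuleCat.of ℤ ℤ) (TopCat.of (UnitAddTorus (Fin 0))) (by simp))
      have : Subsingleton (singularHomologyZ (UnitAddTorus (Fin 0)) (i + 1)) := this
      rw [Nat.choose_zero_succ]
      exact ⟨0⟩
  | succ n ih =>
    obtain ⟨e⟩ := singularHomologyZ_congr (unitAddTorusSucc n) i
    rcases i with _ | i
    · obtain ⟨e1⟩ := singularHomologyZ_prod_circle_zero (UnitAddTorus (Fin n))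
      obtain ⟨e2⟩ := ih 0
      rw [Nat.choose_zero_right] at e2 ⊢
      exact ⟨e.symm ≪≫ₗ e1.symm ≪≫ₗ e2⟩
    · obtain ⟨e1⟩ := ih (i + 1)
      obtain ⟨e2⟩ := ih i
      obtain ⟨e3⟩ := singularHomologyZ_prod_circle_succ _ i e1 e2
      rw [Nat.choose_succ_succ, add_comm (n.choose i)]
      exact ⟨e.symm ≪≫ₗ e3⟩

/-! ### Graded contractions -/

/-- The operator on `X →₀ R` that multiplies the generator `x` by `a x`. -/
noncomputable def Finsupp.diag {R X : Type*} [CommRing R] (a : X → R) : (X →₀ R) →ₗ[R] (X →₀ R) :=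
  Finsupp.linearCombination R fun x => a x • Finsupp.single x 1

theorem Finsupp.diag_single {R X : Type*} [CommRing R] (a : X → R) (x : X) :
    Finsupp.diag a (Finsupp.single x 1) = a x • Finsupp.single x 1 := by
  simp [Finsupp.diag]

theorem Finsupp.diag_apply {R X : Type*} [CommRing R] (a : X → R) (f : X →₀ R) (x : X) :
    Finsupp.diag a f x = a x * f x := by
  induction f using Finsupp.induction_linear with
  | zero => simp
  | add f g hf hg => rw [map_add, Finsupp.add_apply, hf, hg, Finsupp.add_apply, mul_add]
  | single y c =>
    rw [Finsupp.diag, Finsupp.linearCombination_single]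
    by_cases h : y = x
    · subst h; simp [mul_comm]
    · simp [h]

theorem Finsupp.diag_eq_self_iff {X : Type*} (p : X → Prop) [DecidablePred p] (f : X →₀ ℤ) :
    Finsupp.diag (fun x => if p x then 1 else 0) f = f ↔ ∀ x ∈ f.support, p x := by
  simp only [Finsupp.ext_iff, Finsupp.diag_apply, Finsupp.mem_support_iff]
  refine forall_congr' fun x => ?_
  by_cases h : p x <;> simp [h, eq_comm]

/-- Expresses homogeneity of degree `d` as an eigenvector equation, since `2 ^ ·` is injective and
`ℤ` has no zero divisors. Graded statements thereby become identities between operators on one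
ungraded module. -/
theorem Finsupp.diag_pow_eq_iff {X : Type*} (a : X → ℕ) (d : ℕ) (f : X →₀ ℤ) :
    Finsupp.diag (fun x => 2 ^ a x) f = (2 ^ d : ℤ) • f ↔ ∀ x ∈ f.support, a x = d := by
  simp only [Finsupp.ext_iff, Finsupp.diag_apply, Finsupp.mem_support_iff, Finsupp.smul_apply,
    smul_eq_mul]
  refine forall_congr' fun x => ?_
  by_cases h : f x = 0
  · simp [h]
  · simp only [mul_eq_mul_right_iff, h, or_false, ne_eq, not_false_eq_true, forall_const]
    exact pow_right_inj₀ (by norm_num) (by norm_num)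

/-- Deformation retraction data from a complex `M` with grading operators `θ t = t ^ deg`, and
boundary operator `D`, onto a graded module `T` with zero boundary. The homotopy is between `g ∘ f`
and the projector `π` onto a subcomplex. -/
structure GradedContraction {R M T : Type*} [CommRing R] [AddCommGroup M] [Module R M]
    [AddCommGroup T] [Module R T]
    (θ : R → M →ₗ[R] M) (D π : M →ₗ[R] M) (τ : R → T →ₗ[R] T) where
  f : M →ₗ[R] T
  g : T →ₗ[R] M
  s : M →ₗ[R] M
  sign_sign : θ (-1) ∘ₗ θ (-1) = LinearMap.id
  θ_comm : ∀ a b, θ a ∘ₗ θ b = θ b ∘ₗ θ a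
  θ_D : ∀ t, D ∘ₗ θ t = t • (θ t ∘ₗ D)
  θ_π : ∀ t, π ∘ₗ θ t = θ t ∘ₗ π
  θ_f : ∀ t, τ t ∘ₗ f = f ∘ₗ θ t
  θ_g : ∀ t, θ t ∘ₗ g = g ∘ₗ τ t
  θ_s : ∀ t, θ t ∘ₗ s = t • (s ∘ₗ θ t)
  π_π : π ∘ₗ π = π
  π_D : π ∘ₗ D = D ∘ₗ π
  π_g : π ∘ₗ g = g
  π_s : π ∘ₗ s = s
  f_D : f ∘ₗ D = 0
  D_g : D ∘ₗ g = 0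
  f_g : f ∘ₗ g = LinearMap.id
  homotopy : D ∘ₗ s + s ∘ₗ D = π - g ∘ₗ f

namespace GradedContraction

variable {R M T M' T' : Type*} [CommRing R] [AddCommGroup M] [AddCommGroup T] [AddCommGroup M']
  [AddCommGroup T'] [Module R M] [Module R T] [Module R M'] [Module R T']
  {θ : R → M →ₗ[R] M} {D π : M →ₗ[R] M} {τ : R → T →ₗ[R] T}
  {θ' : R → M' →ₗ[R] M'} {D' π' : M' →ₗ[R] M'} {τ' : R → T' →ₗ[R] T'}

/-- The identity contraction of a module with zero boundary in degree zero. -/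
noncomputable def refl (R M : Type*) [CommRing R] [AddCommGroup M] [Module R M] :
    GradedContraction (fun _ : R => (LinearMap.id : M →ₗ[R] M)) 0 LinearMap.id
      (fun _ => (LinearMap.id : M →ₗ[R] M)) where
  f := LinearMap.id
  g := LinearMap.id
  s := 0
  sign_sign := rfl
  θ_comm _ _ := rfl
  θ_D _ := by simp
  θ_π _ := rfl
  θ_f _ := rfl
  θ_g _ := rfl
  θ_s _ := by simp
  π_π := rfl
  π_D := rfl
  π_g := rfl
  π_s := rfl
  f_D := rfl
  D_g := rfl
  f_g := rfl
  homotopy := by simp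

open TensorProduct in
/-- The tensor product of two graded contractions. -/
noncomputable def tensor (c : GradedContraction θ D π τ) (c' : GradedContraction θ' D' π' τ') :
    GradedContraction (fun t => map (θ t) (θ' t)) (map D LinearMap.id + map (θ (-1)) D')
      (map π π') (fun t => map (τ t) (τ' t)) where
  f := map c.f c'.f
  g := map c.g c'.g
  -- The usual homotopy for a tensor product: contract the left factor first, then the right factor
  -- over the retract `g ∘ f` of the left. The Koszul sign of passing a degree one operator across
  -- the left factor is `θ (-1)`.
  s := map c.s π' + map (θ (-1) ∘ₗ c.g ∘ₗ c.f) c'.s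
  sign_sign := by rw [← map_comp, c.sign_sign, c'.sign_sign, map_id]
  θ_comm a b := by rw [← map_comp, ← map_comp, c.θ_comm, c'.θ_comm]
  θ_D t := by
    simp only [LinearMap.add_comp, LinearMap.comp_add, ← map_comp, c.θ_D, c'.θ_D, smul_add,
      LinearMap.id_comp, LinearMap.comp_id, map_smul_left, map_smul_right, c.θ_comm (-1) t]
  θ_π t := by rw [← map_comp, ← map_comp, c.θ_π, c'.θ_π]
  θ_f t := by rw [← map_comp, ← map_comp, c.θ_f, c'.θ_f]
  θ_g t := by rw [← map_comp, ← map_comp, c.θ_g, c'.θ_g]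
  θ_s t := by
    have h : θ t ∘ₗ θ (-1) ∘ₗ c.g ∘ₗ c.f = (θ (-1) ∘ₗ c.g ∘ₗ c.f) ∘ₗ θ t := by
      ext x
      have h1 := LinearMap.congr_fun (c.θ_comm t (-1)) (c.g (c.f x))
      have h2 := LinearMap.congr_fun (c.θ_g t) (c.f x)
      have h3 := LinearMap.congr_fun (c.θ_f t) x
      simp only [LinearMap.comp_apply] at h1 h2 h3 ⊢
      rw [h1, h2, h3]
    simp only [LinearMap.add_comp, LinearMap.comp_add, ← map_comp, c.θ_s, c'.θ_s, smul_add,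
      map_smul_left, map_smul_right, h, c'.θ_π]
  π_π := by rw [← map_comp, c.π_π, c'.π_π]
  π_D := by
    simp only [LinearMap.add_comp, LinearMap.comp_add, ← map_comp, c.π_D, c'.π_D, c.θ_π,
      LinearMap.id_comp, LinearMap.comp_id]
  π_g := by rw [← map_comp, c.π_g, c'.π_g]
  π_s := by
    have h : π ∘ₗ θ (-1) ∘ₗ c.g ∘ₗ c.f = θ (-1) ∘ₗ c.g ∘ₗ c.f := by
      rw [← LinearMap.comp_assoc, c.θ_π, LinearMap.comp_assoc, ← LinearMap.comp_assoc c.f, c.π_g]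
    simp only [LinearMap.comp_add, ← map_comp, c.π_s, c'.π_s, c'.π_π, h]
  f_D := by
    simp only [LinearMap.comp_add, ← map_comp, c.f_D, c'.f_D, map_zero_left, map_zero_right,
      add_zero]
  D_g := by
    simp only [LinearMap.add_comp, ← map_comp, c.D_g, c'.D_g, map_zero_left, map_zero_right,
      add_zero]
  f_g := by rw [← map_comp, c.f_g, c'.f_g, map_id]
  homotopy := by
    have h1 : D ∘ₗ θ (-1) ∘ₗ c.g ∘ₗ c.f = 0 := by
      rw [← LinearMap.comp_assoc, c.θ_D, LinearMap.smul_comp, LinearMap.comp_assoc,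
        ← LinearMap.comp_assoc c.f, c.D_g]
      simp
    have h2 : (θ (-1) ∘ₗ c.g ∘ₗ c.f) ∘ₗ D = 0 := by
      simp only [LinearMap.comp_assoc, c.f_D, LinearMap.comp_zero]
    have h3 : θ (-1) ∘ₗ θ (-1) ∘ₗ c.g ∘ₗ c.f = c.g ∘ₗ c.f := by
      rw [← LinearMap.comp_assoc, c.sign_sign, LinearMap.id_comp]
    have h4 : (θ (-1) ∘ₗ c.g ∘ₗ c.f) ∘ₗ θ (-1) = c.g ∘ₗ c.f := by
      ext x
      have h1 := LinearMap.congr_fun c.sign_sign (c.g (c.f x))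
      have h2 := LinearMap.congr_fun (c.θ_g (-1)) (c.f x)
      have h3 := LinearMap.congr_fun (c.θ_f (-1)) x
      simp only [LinearMap.comp_apply, LinearMap.id_apply] at h1 h2 h3 ⊢
      rw [← h3, ← h2, h1]
    -- `θ (-1)` anticommutes with `s`, so the two mixed terms that pair `s` with `D'` cancel.
    have h5 := c.θ_s (-1)
    -- The rest is `π ⊗ π' - gf ⊗ g'f' = (π - gf) ⊗ π' + gf ⊗ (π' - g'f')`, one summand from each
    -- homotopy.
    have h6 := congr(map $(c.homotopy) π')
    have h7 := congr(map (c.g ∘ₗ c.f) $(c'.homotopy))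
    rw [map_add_left, sub_eq_add_neg, map_add_left, ← neg_one_smul R (c.g ∘ₗ c.f),
      map_smul_left] at h6
    rw [map_add_right, sub_eq_add_neg, map_add_right, ← neg_one_smul R (c'.g ∘ₗ c'.f),
      map_smul_right] at h7
    simp only [LinearMap.add_comp, LinearMap.comp_add, ← map_comp, LinearMap.id_comp,
      LinearMap.comp_id, h1, h2, h3, h4, h5, c'.π_D, map_zero_left, map_smul_left]
    linear_combination (norm := module) h6 + h7

/-- Transport of a graded contraction along linear equivalences. -/
noncomputable def congr (c : GradedContraction θ D π τ) (e : M ≃ₗ[R] M') (e' : T ≃ₗ[R] T')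
    (hθ : ∀ t, e.toLinearMap ∘ₗ θ t = θ' t ∘ₗ e.toLinearMap)
    (hD : e.toLinearMap ∘ₗ D = D' ∘ₗ e.toLinearMap)
    (hπ : e.toLinearMap ∘ₗ π = π' ∘ₗ e.toLinearMap)
    (hτ : ∀ t, e'.toLinearMap ∘ₗ τ t = τ' t ∘ₗ e'.toLinearMap) :
    GradedContraction θ' D' π' τ' := by
  obtain rfl : θ' = fun t => e.conj (θ t) := by
    funext t
    rw [LinearEquiv.conj_apply, hθ, LinearMap.comp_assoc, LinearEquiv.comp_symm, LinearMap.comp_id]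
  obtain rfl : τ' = fun t => e'.conj (τ t) := by
    funext t
    rw [LinearEquiv.conj_apply, hτ, LinearMap.comp_assoc, LinearEquiv.comp_symm, LinearMap.comp_id]
  obtain rfl : D' = e.conj D := by
    rw [LinearEquiv.conj_apply, hD, LinearMap.comp_assoc, LinearEquiv.comp_symm, LinearMap.comp_id]
  obtain rfl : π' = e.conj π := by
    rw [LinearEquiv.conj_apply, hπ, LinearMap.comp_assoc, LinearEquiv.comp_symm, LinearMap.comp_id]
  have hf (x) := LinearMap.congr_fun c.f_D x
  have hg (x) := LinearMap.congr_fun c.D_g x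
  have h1 (x) := LinearMap.congr_fun c.sign_sign x
  have h2 (a b x) := LinearMap.congr_fun (c.θ_comm a b) x
  have h3 (a x) := LinearMap.congr_fun (c.θ_D a) x
  have h4 (a x) := LinearMap.congr_fun (c.θ_π a) x
  have h5 (a x) := LinearMap.congr_fun (c.θ_f a) x
  have h6 (a x) := LinearMap.congr_fun (c.θ_g a) x
  have h7 (a x) := LinearMap.congr_fun (c.θ_s a) x
  have h8 (x) := LinearMap.congr_fun c.π_π x
  have h9 (x) := LinearMap.congr_fun c.π_D x
  have h10 (x) := LinearMap.congr_fun c.π_g x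
  have h11 (x) := LinearMap.congr_fun c.π_s x
  have h12 (x) := LinearMap.congr_fun c.f_g x
  have h13 (x) := LinearMap.congr_fun c.homotopy x
  simp only [LinearMap.comp_apply, LinearMap.id_apply, LinearMap.zero_apply, LinearMap.smul_apply,
    LinearMap.add_apply, LinearMap.sub_apply] at hf hg h1 h2 h3 h4 h5 h6 h7 h8 h9 h10 h11 h12 h13
  exact
    { f := e'.toLinearMap ∘ₗ c.f ∘ₗ e.symm.toLinearMap
      g := e.toLinearMap ∘ₗ c.g ∘ₗ e'.symm.toLinearMap
      s := e.conj c.s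
      sign_sign := by ext x; simp [LinearEquiv.conj_apply, h1]
      θ_comm := by intro a b; ext x; simp [LinearEquiv.conj_apply, h2 a b]
      θ_D := by intro a; ext x; simp [LinearEquiv.conj_apply, h3]
      θ_π := by intro a; ext x; simp [LinearEquiv.conj_apply, h4]
      θ_f := by intro a; ext x; simp [LinearEquiv.conj_apply, h5]
      θ_g := by intro a; ext x; simp [LinearEquiv.conj_apply, h6]
      θ_s := by intro a; ext x; simp [LinearEquiv.conj_apply, h7]
      π_π := by ext x; simp [LinearEquiv.conj_apply, h8]
      π_D := by ext x; simp [LinearEquiv.conj_apply, h9]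
      π_g := by ext x; simp [LinearEquiv.conj_apply, h10]
      π_s := by ext x; simp [LinearEquiv.conj_apply, h11]
      f_D := by ext x; simp [LinearEquiv.conj_apply, hf]
      D_g := by ext x; simp [LinearEquiv.conj_apply, hg]
      f_g := by ext x; simp [h12]
      homotopy := by ext x; simp [LinearEquiv.conj_apply, ← map_add, h13] }

end GradedContraction

/-! ### Splitting off the first entry of a tuple -/

/-- The tensor decomposition of the free module on `(n + 1)`-tuples. -/
noncomputable def consLinearEquiv (R S : Type*) [CommRing R] (n : ℕ) :
    ((S →₀ R) ⊗[R] ((Fin n → S) →₀ R)) ≃ₗ[R] ((Fin (n + 1) → S) →₀ R) :=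
  finsuppTensorFinsupp' R S (Fin n → S) ≪≫ₗ Finsupp.domLCongr (Fin.consEquiv fun _ => S)

theorem consLinearEquiv_single (R S : Type*) [CommRing R] (n : ℕ) (c : S) (σ : Fin n → S) :
    consLinearEquiv R S n (Finsupp.single c 1 ⊗ₜ Finsupp.single σ 1) =
      Finsupp.single (Fin.cons c σ : Fin (n + 1) → S) 1 := by
  simp [consLinearEquiv, Fin.consEquiv]

theorem consLinearEquiv_tmul_single (R S : Type*) [CommRing R] (n : ℕ) (x : S →₀ R) (σ : Fin n → S) :
    consLinearEquiv R S n (x ⊗ₜ Finsupp.single σ 1) =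
      Finsupp.mapDomain (fun c => (Fin.cons c σ : Fin (n + 1) → S)) x := by
  induction x using Finsupp.induction_linear with
  | zero => simp
  | add x y hx hy => rw [TensorProduct.add_tmul, map_add, hx, hy, Finsupp.mapDomain_add]
  | single c a => simp [consLinearEquiv, Fin.consEquiv]

theorem consLinearEquiv_single_tmul (R S : Type*) [CommRing R] (n : ℕ) (c : S) (x : (Fin n → S) →₀ R) :
    consLinearEquiv R S n (Finsupp.single c 1 ⊗ₜ x) =
      Finsupp.mapDomain (fun σ => (Fin.cons c σ : Fin (n + 1) → S)) x := by
  induction x using Finsupp.induction_linear with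
  | zero => simp
  | add x y hx hy => rw [TensorProduct.tmul_add, map_add, hx, hy, Finsupp.mapDomain_add]
  | single c a => simp [consLinearEquiv, Fin.consEquiv]

theorem finsupp_tensor_hom_ext {R X Y M : Type*} [CommRing R] [AddCommGroup M] [Module R M]
    {f g : ((X →₀ R) ⊗[R] (Y →₀ R)) →ₗ[R] M}
    (h : ∀ x y, f (Finsupp.single x 1 ⊗ₜ Finsupp.single y 1) =
      g (Finsupp.single x 1 ⊗ₜ Finsupp.single y 1)) : f = g := by
  ext x y
  exact h x y

theorem consLinearEquiv_diag (R S : Type*) [CommRing R] (n : ℕ) (a : S → R) (b : (Fin n → S) → R)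
    (c : (Fin (n + 1) → S) → R) (h : ∀ x y, c (Fin.cons x y) = a x * b y) :
    (consLinearEquiv R S n).toLinearMap ∘ₗ TensorProduct.map (Finsupp.diag a) (Finsupp.diag b) =
      Finsupp.diag c ∘ₗ (consLinearEquiv R S n).toLinearMap := by
  refine finsupp_tensor_hom_ext fun x y => ?_
  simp only [LinearMap.comp_apply, TensorProduct.map_tmul, LinearEquiv.coe_coe,
    consLinearEquiv_single, Finsupp.diag_single, h, TensorProduct.smul_tmul_smul, map_smul]

/-! ### The tuple complex as a tensor power of the complex of one position -/

namespace VETuple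

variable {k n : ℕ}

/-- The dimension of a cell of the cycle graph. -/
def cellDim (c : CycleCell k) : ℕ := Sum.elim (fun _ => 0) (fun _ => 1) c

/-- The boundary of a cell of the cycle graph, truncated to the vertices in `P`. -/
noncomputable def cellBoundary (P : Finset (ZMod k)) (c : CycleCell k) : CycleCell k →₀ ℤ :=
  Sum.elim (fun _ => 0) (fun i =>
    (if i + 1 ∈ P then Finsupp.single (Sum.inl (i + 1)) 1 else 0) -
      (if i ∈ P then Finsupp.single (Sum.inl i) 1 else 0)) c

theorem dim_eq_sum (σ : VETuple k n) : σ.dim = ∑ j, cellDim (σ j) := by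
  rw [dim, edgePositions, Finset.card_filter]
  refine Finset.sum_congr rfl fun j _ => ?_
  rcases σ j with i | i <;> simp [cellDim]

theorem dim_cons (c : CycleCell k) (σ : VETuple k n) :
    dim (Fin.cons c σ : VETuple k (n + 1)) = cellDim c + σ.dim := by
  simp [dim_eq_sum, Fin.sum_univ_succ]

theorem rho_eq_sum (σ : VETuple k n) (j : Fin n) :
    σ.rho j = ∑ l, if l < j then cellDim (σ l) else 0 := by
  rw [rho, edgePositions, Finset.filter_filter, Finset.card_filter]
  refine Finset.sum_congr rfl fun l _ => ?_
  rcases σ l with i | i <;> simp [cellDim]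

theorem rho_cons_zero (c : CycleCell k) (σ : VETuple k n) :
    rho (Fin.cons c σ : VETuple k (n + 1)) 0 = 0 := by
  simp [rho_eq_sum]

theorem rho_cons_succ (c : CycleCell k) (σ : VETuple k n) (j : Fin n) :
    rho (Fin.cons c σ : VETuple k (n + 1)) j.succ = cellDim c + σ.rho j := by
  simp [rho_eq_sum, Fin.sum_univ_succ]

theorem boundaryAt_cons_zero (P : Finset (ZMod k)) (c : CycleCell k) (σ : VETuple k n) :
    boundaryAt P (Fin.cons c σ : VETuple k (n + 1)) 0 =
      Finsupp.mapDomain (fun c => (Fin.cons c σ : VETuple k (n + 1))) (cellBoundary P c) := by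
  rw [boundaryAt, rho_cons_zero]
  rcases c with i | i
  · simp [cellBoundary]
  · simp only [Fin.cons_zero, Sum.elim_inr, pow_zero, one_smul, cellBoundary, replaceTerm,
      Fin.update_cons_zero, Finsupp.mapDomain_sub]
    split_ifs <;> simp [Finsupp.mapDomain_single]

theorem boundaryAt_cons_succ (P : Finset (ZMod k)) (c : CycleCell k) (σ : VETuple k n)
    (j : Fin n) :
    boundaryAt P (Fin.cons c σ : VETuple k (n + 1)) j.succ = (-1 : ℤ) ^ cellDim c •
      Finsupp.mapDomain (fun σ => (Fin.cons c σ : VETuple k (n + 1))) (boundaryAt P σ j) := by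
  rw [boundaryAt, boundaryAt, rho_cons_succ, Fin.cons_succ]
  rcases σ j with i | i
  · simp
  · simp only [Sum.elim_inr, replaceTerm, ← Fin.cons_update, Finsupp.mapDomain_smul,
      Finsupp.mapDomain_sub, smul_smul, pow_add]
    congr 1
    split_ifs <;> simp [Finsupp.mapDomain_single]

/-- The Leibniz rule: no edge precedes position 0, and every later position has the first entry
before it, which contributes the sign `(-1) ^ cellDim c`. -/
theorem tupleBoundary_cons (P : Finset (ZMod k)) (c : CycleCell k) (σ : VETuple k n) :
    tupleBoundary P (Fin.cons c σ : VETuple k (n + 1)) =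
      Finsupp.mapDomain (fun c => (Fin.cons c σ : VETuple k (n + 1))) (cellBoundary P c) +
      (-1 : ℤ) ^ cellDim c • Finsupp.mapDomain (fun σ => (Fin.cons c σ : VETuple k (n + 1)))
        (tupleBoundary P σ) := by
  rw [tupleBoundary, Fin.sum_univ_succ, boundaryAt_cons_zero, tupleBoundary,
    Finsupp.mapDomain_finsetSum, Finset.smul_sum]
  simp only [boundaryAt_cons_succ]

theorem boundary_single (P : Finset (ZMod k)) (σ : VETuple k n) :
    boundary n P (Finsupp.single σ 1) = tupleBoundary P σ := by
  rw [boundary, Finsupp.linearCombination_single, one_smul]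

/-- Whether the vertices of a cell lie in `P`. -/
def cellIn (P : Finset (ZMod k)) (c : CycleCell k) : Prop :=
  Sum.elim (fun i => i ∈ P) (fun _ => True) c

-- Kills the vertices outside `P`. With this projector the operators can live on all cells, and
-- belonging to the complex becomes the condition of being fixed by it.
open Classical in
noncomputable abbrev cellProj (P : Finset (ZMod k)) : (CycleCell k →₀ ℤ) →ₗ[ℤ] (CycleCell k →₀ ℤ) :=
  Finsupp.diag fun c => if cellIn P c then 1 else 0

open Classical in
noncomputable abbrev tupleProj (n : ℕ) (P : Finset (ZMod k)) :
    (VETuple k n →₀ ℤ) →ₗ[ℤ] (VETuple k n →₀ ℤ) :=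
  Finsupp.diag fun σ => if ∀ j, cellIn P (σ j) then 1 else 0

/-- The linear extension of `cellBoundary`. -/
noncomputable abbrev cellBoundaryMap (P : Finset (ZMod k)) :
    (CycleCell k →₀ ℤ) →ₗ[ℤ] (CycleCell k →₀ ℤ) :=
  Finsupp.linearCombination ℤ (cellBoundary P)

/-- The tensor power of a graded contraction of the cycle graph. -/
noncomputable def tupleContraction {P : Finset (ZMod k)} {S : Type} {deg : S → ℕ}
    (c : GradedContraction (fun t : ℤ => Finsupp.diag fun c : CycleCell k => t ^ cellDim c)
      (cellBoundaryMap P) (cellProj P) (fun t : ℤ => Finsupp.diag fun s => t ^ deg s)) (n : ℕ) :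
    GradedContraction (fun t : ℤ => Finsupp.diag fun σ : VETuple k n => t ^ σ.dim)
      (boundary n P) (tupleProj n P)
      (fun t : ℤ => Finsupp.diag fun τ : Fin n → S => t ^ ∑ j, deg (τ j)) := by
  induction n with
  | zero =>
    have hid {X : Type _} (a : X → ℤ) (h : ∀ x, a x = 1) : Finsupp.diag a = LinearMap.id := by
      ext x : 2
      simp [Finsupp.diag_single, h]
    -- There is a single empty tuple, of dimension 0, so source and target are both free of rank
    -- one.
    refine (GradedContraction.refl ℤ (VETuple k 0 →₀ ℤ)).congr (LinearEquiv.refl _ _)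
      (Finsupp.domLCongr (Equiv.ofUnique _ _)) ?_ ?_ ?_ ?_
    · intro t
      rw [hid _ fun x => by simp [dim_eq_sum]]
      rfl
    · ext σ : 2
      simp [boundary_single, tupleBoundary]
    · rw [tupleProj, hid _ fun x => by simp]
      rfl
    · intro t
      rw [hid _ fun x => by simp]
      rfl
  | succ n ih =>
    refine (c.tensor ih).congr (consLinearEquiv ℤ _ n) (consLinearEquiv ℤ _ n) ?_ ?_ ?_ ?_
    · exact fun t => consLinearEquiv_diag _ _ _ _ _ _ fun x y => by rw [dim_cons, pow_add]
    · refine finsupp_tensor_hom_ext fun x y => ?_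
      simp only [LinearMap.comp_apply, LinearMap.add_apply, TensorProduct.map_tmul, map_add,
        LinearMap.id_apply, LinearEquiv.coe_coe, Finsupp.diag_single,
        boundary_single, tupleBoundary_cons, Finsupp.linearCombination_single, one_smul,
        ← TensorProduct.smul_tmul', map_smul, consLinearEquiv_tmul_single,
        consLinearEquiv_single_tmul, Finsupp.mapDomain_single]
    · refine consLinearEquiv_diag _ _ _ _ _ _ fun x y => ?_
      have hiff : (∀ j, cellIn P ((Fin.cons x y : VETuple k (n + 1)) j)) ↔
          cellIn P x ∧ ∀ j, cellIn P (y j) := Fin.forall_fin_succ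
      by_cases hx : cellIn P x
      · by_cases hy : ∀ j, cellIn P (y j)
        · rw [if_pos (hiff.2 ⟨hx, hy⟩), if_pos hx, if_pos hy, one_mul]
        · rw [if_neg fun h => hy (hiff.1 h).2, if_neg hy, mul_zero]
      · rw [if_neg fun h => hx (hiff.1 h).1, if_neg hx, zero_mul]
    · exact fun t => consLinearEquiv_diag _ _ _ _ _ _ fun x y => by
        rw [Fin.sum_univ_succ, pow_add]; simp

end VETuple

/-! ### Explicit contractions of the cycle graph -/

namespace VETuple

variable {k : ℕ}

theorem cellBoundaryMap_inl (P : Finset (ZMod k)) (i : ZMod k) :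
    cellBoundaryMap P (Finsupp.single (Sum.inl i) 1) = 0 := by
  simp [cellBoundary]

theorem cellBoundaryMap_inr (P : Finset (ZMod k)) (i : ZMod k) :
    cellBoundaryMap P (Finsupp.single (Sum.inr i) 1) =
      (if i + 1 ∈ P then Finsupp.single (Sum.inl (i + 1)) 1 else 0) -
        (if i ∈ P then Finsupp.single (Sum.inl i) 1 else 0) := by
  simp [cellBoundary]

/-- To build a graded contraction of the cycle graph it suffices to check identities
on generators. -/
noncomputable def cycleContraction {P : Finset (ZMod k)} {S : Type} {deg : S → ℕ}
    (f : (CycleCell k →₀ ℤ) →ₗ[ℤ] (S →₀ ℤ)) (g : (S →₀ ℤ) →ₗ[ℤ] (CycleCell k →₀ ℤ))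
    (s : (CycleCell k →₀ ℤ) →ₗ[ℤ] (CycleCell k →₀ ℤ))
    (θ_f : ∀ (t : ℤ) c, Finsupp.diag (fun x => t ^ deg x) (f (Finsupp.single c 1)) =
      t ^ cellDim c • f (Finsupp.single c 1))
    (θ_g : ∀ (t : ℤ) c, Finsupp.diag (fun x => t ^ cellDim x) (g (Finsupp.single c 1)) =
      t ^ deg c • g (Finsupp.single c 1))
    (θ_s : ∀ (t : ℤ) c, Finsupp.diag (fun x => t ^ cellDim x) (s (Finsupp.single c 1)) =
      t ^ (cellDim c + 1) • s (Finsupp.single c 1))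
    (π_g : ∀ c, cellProj P (g (Finsupp.single c 1)) = g (Finsupp.single c 1))
    (π_s : ∀ c, cellProj P (s (Finsupp.single c 1)) = s (Finsupp.single c 1))
    (f_D : ∀ i, f (cellBoundaryMap P (Finsupp.single (Sum.inr i) 1)) = 0)
    (D_g : ∀ c, cellBoundaryMap P (g (Finsupp.single c 1)) = 0)
    (f_g : ∀ c, f (g (Finsupp.single c 1)) = Finsupp.single c 1)
    (homotopy : ∀ c, cellBoundaryMap P (s (Finsupp.single c 1)) +
      s (cellBoundaryMap P (Finsupp.single c 1)) =
        cellProj P (Finsupp.single c 1) - g (f (Finsupp.single c 1))) :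
    GradedContraction (fun t : ℤ => Finsupp.diag fun c : CycleCell k => t ^ cellDim c)
      (cellBoundaryMap P) (cellProj P) (fun t : ℤ => Finsupp.diag fun s => t ^ deg s) where
  f := f
  g := g
  s := s
  sign_sign := by
    refine Finsupp.lhom_ext' fun c => LinearMap.ext_ring ?_
    simp only [LinearMap.comp_apply, Finsupp.lsingle_apply, Finsupp.diag_single, map_smul,
      smul_smul, ← mul_pow, neg_one_mul, neg_neg, one_pow, one_smul, LinearMap.id_apply]
  θ_comm a b := by
    refine Finsupp.lhom_ext' fun c => LinearMap.ext_ring ?_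
    simp only [LinearMap.comp_apply, Finsupp.lsingle_apply, Finsupp.diag_single, map_smul,
      smul_smul, mul_comm]
  θ_D t := by
    refine Finsupp.lhom_ext' fun c => LinearMap.ext_ring ?_
    simp only [LinearMap.comp_apply, Finsupp.lsingle_apply, Finsupp.diag_single, map_smul,
      LinearMap.smul_apply]
    rcases c with i | i
    · simp only [cellBoundaryMap_inl, smul_zero, map_zero]
    · rw [cellBoundaryMap_inr, map_sub]
      split_ifs <;> simp [Finsupp.diag_single, cellDim]
  θ_π t := by
    refine Finsupp.lhom_ext' fun c => LinearMap.ext_ring ?_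
    simp only [LinearMap.comp_apply, Finsupp.lsingle_apply, Finsupp.diag_single, map_smul,
      smul_smul, mul_comm]
  θ_f t := by
    refine Finsupp.lhom_ext' fun c => LinearMap.ext_ring ?_
    simp only [LinearMap.comp_apply, Finsupp.lsingle_apply, Finsupp.diag_single, map_smul, θ_f]
  θ_g t := by
    refine Finsupp.lhom_ext' fun c => LinearMap.ext_ring ?_
    simp only [LinearMap.comp_apply, Finsupp.lsingle_apply, Finsupp.diag_single, map_smul, θ_g]
  θ_s t := by
    refine Finsupp.lhom_ext' fun c => LinearMap.ext_ring ?_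
    simp only [LinearMap.comp_apply, Finsupp.lsingle_apply, Finsupp.diag_single, map_smul, θ_s,
      LinearMap.smul_apply, pow_succ', mul_smul]
  π_π := by
    refine Finsupp.lhom_ext' fun c => LinearMap.ext_ring ?_
    simp only [LinearMap.comp_apply, Finsupp.lsingle_apply, Finsupp.diag_single, map_smul]
    split_ifs <;> simp
  π_D := by
    refine Finsupp.lhom_ext' fun c => LinearMap.ext_ring ?_
    simp only [LinearMap.comp_apply, Finsupp.lsingle_apply, Finsupp.diag_single, map_smul]
    rcases c with i | i
    · simp only [cellBoundaryMap_inl, smul_zero, map_zero]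
    · rw [cellBoundaryMap_inr, map_sub]
      split_ifs <;> simp_all [Finsupp.diag_single, cellIn]
  π_g := by
    refine Finsupp.lhom_ext' fun c => LinearMap.ext_ring ?_
    exact π_g c
  π_s := by
    refine Finsupp.lhom_ext' fun c => LinearMap.ext_ring ?_
    exact π_s c
  f_D := by
    refine Finsupp.lhom_ext' fun c => LinearMap.ext_ring ?_
    rcases c with i | i
    · simp only [LinearMap.comp_apply, Finsupp.lsingle_apply, cellBoundaryMap_inl, map_zero,
        LinearMap.zero_apply]
    · exact f_D i
  D_g := by
    refine Finsupp.lhom_ext' fun c => LinearMap.ext_ring ?_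
    exact D_g c
  f_g := by
    refine Finsupp.lhom_ext' fun c => LinearMap.ext_ring ?_
    exact f_g c
  homotopy := by
    refine Finsupp.lhom_ext' fun c => LinearMap.ext_ring ?_
    exact homotopy c

/-! ### Proper `P`: arcs ending outside `P` -/

section Proper

variable (P : Finset (ZMod k))

/-- The sum of the edges from `v_i` up to the next vertex outside `P`. -/
noncomputable def arc (i : ZMod k) : CycleCell k →₀ ℤ :=
  ∑ m ∈ Finset.range k, if ∀ l < m, i + 1 + (l : ZMod k) ∈ P then
    Finsupp.single (Sum.inr (i + (m : ZMod k))) 1 else 0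

variable {P}
variable [NeZero k] (hP : P ≠ Finset.univ)
include hP

/-- Cutting the cycle at a vertex `a` outside `P` turns it into a line. At `a - 1` the premise of
`h` is vacuous, and walking backwards from there reaches every index. -/
theorem arc_induction {motive : ZMod k → Prop}
    (h : ∀ i, (i + 1 ∈ P → motive (i + 1)) → motive i) (i : ZMod k) : motive i := by
  obtain ⟨a, ha⟩ : ∃ a, a ∉ P := by simpa [Finset.eq_univ_iff_forall] using hP
  have key : ∀ m : ℕ, motive (a - 1 - m) := by
    intro m
    induction m with
    | zero =>
      refine h _ fun h' => absurd ?_ ha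
      simpa using h'
    | succ m ih =>
      refine h _ fun _ => ?_
      convert ih using 1
      push_cast; ring
  have := key (a - 1 - i).val
  rwa [ZMod.natCast_zmod_val, sub_sub_cancel] at this

/-- The recursion that replaces the closed formula in everything that follows: an arc is its first
edge, continued exactly when the next vertex lies in `P`. -/
theorem arc_eq (i : ZMod k) :
    arc P i = Finsupp.single (Sum.inr i) 1 + if i + 1 ∈ P then arc P (i + 1) else 0 := by
  obtain ⟨d, rfl⟩ : ∃ d, k = d + 1 := ⟨k - 1, by have := NeZero.pos k; omega⟩
  rw [arc, Finset.sum_range_succ']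
  refine (add_comm _ _).trans ?_
  congr 1
  · simp
  split_ifs with hi
  -- Both arcs are sums over `k` terms, so the shift leaves one extra term in the second. Its
  -- condition, together with `i + 1 ∈ P`, would put all of `ℤ/k` in `P`.
  · rw [arc, Finset.sum_range_succ, if_neg, add_zero]
    · refine Finset.sum_congr rfl fun m _ => ?_
      refine if_congr ?_ (by push_cast; ring_nf) rfl
      constructor
      · intro h l hl
        have := h (l + 1) (by omega)
        push_cast at this
        rwa [add_right_comm, add_assoc (i + 1)]
      · rintro h (_ | l) hl
        · simpa using hi
        · have := h l (by omega)
          push_cast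
          rwa [add_right_comm, add_assoc (i + 1)] at this
    · intro h
      refine hP (Finset.eq_univ_iff_forall.2 fun x => ?_)
      have hx : i + 1 + ((x - (i + 1)).val : ZMod (d + 1)) = x := by
        rw [ZMod.natCast_zmod_val]; ring
      have hlt := ZMod.val_lt (x - (i + 1))
      rcases hv : (x - (i + 1)).val with _ | l
      · rw [hv, Nat.cast_zero, add_zero] at hx
        exact hx ▸ hi
      · rw [hv] at hx hlt
        have := h l (by omega)
        rw [← hx]
        push_cast
        rwa [add_right_comm, add_assoc (i + 1)] at this
  · refine Finset.sum_eq_zero fun m _ => if_neg fun h => hi ?_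
    simpa using h 0 (by omega)

theorem cellBoundaryMap_arc (i : ZMod k) : cellBoundaryMap P (arc P i) =
    - if i ∈ P then Finsupp.single (Sum.inl i) 1 else 0 := by
  induction i using arc_induction hP with | _ i ih
  rw [arc_eq hP, map_add, cellBoundaryMap_inr]
  split_ifs with h1 h2 h2 <;> (simp_all; try abel)

theorem diag_arc (t : ℤ) (i : ZMod k) :
    Finsupp.diag (fun x : CycleCell k => t ^ cellDim x) (arc P i) = t • arc P i := by
  induction i using arc_induction hP with | _ i ih
  rw [arc_eq hP, map_add, Finsupp.diag_single]
  split_ifs with h1 <;> simp_all [cellDim]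

theorem cellProj_arc (i : ZMod k) : cellProj P (arc P i) = arc P i := by
  induction i using arc_induction hP with | _ i ih
  rw [arc_eq hP, map_add, Finsupp.diag_single]
  split_ifs with h1 <;> simp_all [cellIn]

/-- The contraction onto the free module on the vertices outside `P`. -/
noncomputable def properContraction :
    GradedContraction (fun t : ℤ => Finsupp.diag fun c : CycleCell k => t ^ cellDim c)
      (cellBoundaryMap P) (cellProj P)
      (fun t : ℤ => Finsupp.diag fun _ : {i // i ∉ P} => t ^ 1) := by
  -- An arc contains exactly one edge that starts outside `P` if its own start is outside, and none
  -- otherwise; hence `f` reads off the class. An arc starting at a vertex of `P` has boundary minus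
  -- that vertex, whence the sign in `s`.
  let f : (CycleCell k →₀ ℤ) →ₗ[ℤ] ({i // i ∉ P} →₀ ℤ) :=
    Finsupp.linearCombination ℤ (Sum.elim (fun _ => 0)
      fun i => if h : i ∉ P then Finsupp.single ⟨i, h⟩ 1 else 0)
  let g : ({i // i ∉ P} →₀ ℤ) →ₗ[ℤ] (CycleCell k →₀ ℤ) :=
    Finsupp.linearCombination ℤ fun i => arc P i
  let s : (CycleCell k →₀ ℤ) →ₗ[ℤ] (CycleCell k →₀ ℤ) :=
    Finsupp.linearCombination ℤ (Sum.elim (fun i => if i ∈ P then - arc P i else 0) fun _ => 0)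
  have f_inl (i) : f (Finsupp.single (Sum.inl i) 1) = 0 := by simp [f]
  have f_inr (i) : f (Finsupp.single (Sum.inr i) 1) =
    if h : i ∉ P then Finsupp.single ⟨i, h⟩ 1 else 0 := by simp [f]
  have g_single (i) : g (Finsupp.single i 1) = arc P i := by simp [g]
  have s_inl (i) : s (Finsupp.single (Sum.inl i) 1) = if i ∈ P then - arc P i else 0 := by simp [s]
  have s_inr (i) : s (Finsupp.single (Sum.inr i) 1) = 0 := by simp [s]
  have f_arc (i) : f (arc P i) = if h : i ∉ P then Finsupp.single ⟨i, h⟩ 1 else 0 := by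
    induction i using arc_induction hP with | _ i ih
    rw [arc_eq hP, map_add, f_inr]
    split_ifs <;> simp_all
  refine cycleContraction f g s ?_ ?_ ?_ ?_ ?_ ?_ ?_ ?_ ?_
  · rintro t (i | i)
    · simp [f_inl]
    · rw [f_inr]
      split_ifs <;> simp [cellDim, Finsupp.diag_single]
  · intro t i
    rw [g_single, diag_arc hP, pow_one]
  · rintro t (i | i)
    · rw [s_inl]
      split_ifs
      · rw [map_neg, diag_arc hP]
        simp [cellDim]
      · simp
    · simp [s_inr]
  · intro i
    rw [g_single, cellProj_arc hP]
  · rintro (i | i)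
    · rw [s_inl]
      split_ifs <;> simp only [map_neg, cellProj_arc hP, map_zero]
    · simp [s_inr]
  · intro i
    rw [cellBoundaryMap_inr, map_sub]
    split_ifs <;> simp [f_inl]
  · rintro ⟨i, hi⟩
    rw [g_single, cellBoundaryMap_arc hP, if_neg hi, neg_zero]
  · rintro ⟨i, hi⟩
    rw [g_single, f_arc, dif_pos hi]
  · rintro (i | i)
    · rw [s_inl, cellBoundaryMap_inl, f_inl, Finsupp.diag_single]
      split_ifs with h h' h' <;> simp_all [cellBoundaryMap_arc hP, cellIn]
    · rw [s_inr, cellBoundaryMap_inr, f_inr, Finsupp.diag_single, map_sub]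
      have := arc_eq hP i
      split_ifs with h1 h2 h3 <;> simp_all [cellIn]

end Proper

/-! ### `P = ℤ/k`: contraction along a spanning path -/

section Full

/-- The sum of the edges `e_0, …, e_{m - 1}`. -/
noncomputable def initialArc (k m : ℕ) : CycleCell k →₀ ℤ :=
  ∑ l ∈ Finset.range m, Finsupp.single (Sum.inr (l : ZMod k)) 1

theorem cellBoundaryMap_initialArc [NeZero k] (m : ℕ) :
    cellBoundaryMap Finset.univ (initialArc k m) =
      Finsupp.single (Sum.inl (m : ZMod k)) 1 - Finsupp.single (Sum.inl 0) 1 := by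
  rw [initialArc, map_sum]
  simp only [cellBoundaryMap_inr, Finset.mem_univ, if_true]
  simpa using Finset.sum_range_sub
    (fun l : ℕ => (Finsupp.single (Sum.inl (l : ZMod k)) 1 : CycleCell k →₀ ℤ)) m

theorem diag_initialArc (t : ℤ) (m : ℕ) :
    Finsupp.diag (fun x : CycleCell k => t ^ cellDim x) (initialArc k m) = t • initialArc k m := by
  rw [initialArc, map_sum, Finset.smul_sum]
  refine Finset.sum_congr rfl fun l _ => ?_
  rw [Finsupp.diag_single, cellDim, Sum.elim_inr, pow_one]

theorem cellProj_univ [NeZero k] (x : CycleCell k →₀ ℤ) : cellProj Finset.univ x = x := by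
  rw [cellProj, Finsupp.diag_eq_self_iff]
  rintro (i | i) _ <;> simp [cellIn]

/-- The contraction of the cycle graph onto the homology of the circle. -/
noncomputable def fullContraction (k : ℕ) [NeZero k] :
    GradedContraction (fun t : ℤ => Finsupp.diag fun c : CycleCell k => t ^ cellDim c)
      (cellBoundaryMap Finset.univ) (cellProj Finset.univ)
      (fun t : ℤ => Finsupp.diag fun b : Bool => t ^ b.toNat) := by
  -- The edges other than `e_{-1}` form a spanning path. `f` counts vertices and passages through
  -- `e_{-1}`, `g` picks `v_0` and the full loop, and `s` sends a vertex to the path from `v_0` to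
  -- it.
  let f : (CycleCell k →₀ ℤ) →ₗ[ℤ] (Bool →₀ ℤ) :=
    Finsupp.linearCombination ℤ (Sum.elim (fun _ => Finsupp.single false 1)
      fun i => if i + 1 = 0 then Finsupp.single true 1 else 0)
  let g : (Bool →₀ ℤ) →ₗ[ℤ] (CycleCell k →₀ ℤ) :=
    Finsupp.linearCombination ℤ fun b =>
      if b then initialArc k k else Finsupp.single (Sum.inl 0) 1
  let s : (CycleCell k →₀ ℤ) →ₗ[ℤ] (CycleCell k →₀ ℤ) :=
    Finsupp.linearCombination ℤ (Sum.elim (fun i => initialArc k i.val) fun _ => 0)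
  have f_inl (i) : f (Finsupp.single (Sum.inl i) 1) = Finsupp.single false 1 := by simp [f]
  have f_inr (i) : f (Finsupp.single (Sum.inr i) 1) =
    if i + 1 = 0 then Finsupp.single true 1 else 0 := by simp [f]
  have g_true : g (Finsupp.single true 1) = initialArc k k := by simp [g]
  have g_false : g (Finsupp.single false 1) = Finsupp.single (Sum.inl 0) 1 := by simp [g]
  have s_inl (i) : s (Finsupp.single (Sum.inl i) 1) = initialArc k i.val := by simp [s]
  have s_inr (i) : s (Finsupp.single (Sum.inr i) 1) = 0 := by simp [s]
  have f_arc : f (initialArc k k) = Finsupp.single true 1 := by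
    obtain ⟨d, hd⟩ : ∃ d, k = d + 1 := ⟨k - 1, by have := NeZero.pos k; omega⟩
    rw [initialArc, map_sum]
    rw [Finset.sum_eq_single_of_mem d (by simp [hd])]
    · rw [f_inr, if_pos]
      rw [← Nat.cast_succ, Nat.succ_eq_add_one, ← hd, ZMod.natCast_self]
    · intro m hm hmd
      rw [f_inr, if_neg]
      rw [← Nat.cast_succ, ZMod.natCast_eq_zero_iff]
      intro h
      have := Nat.le_of_dvd (by omega) h
      have := Finset.mem_range.1 hm
      omega
  -- An edge is the difference of the paths to its two ends, except for the closing edge, where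
  -- `val` wraps round to 0 and the full loop is the correction.
  have s_edge (i : ZMod k) : initialArc k (i + 1).val - initialArc k i.val =
      Finsupp.single (Sum.inr i) 1 - if i + 1 = 0 then initialArc k k else 0 := by
    have h1 : initialArc k (i.val + 1) = initialArc k i.val + Finsupp.single (Sum.inr i) 1 := by
      rw [initialArc, Finset.sum_range_succ, ZMod.natCast_zmod_val, initialArc]
    have h2 : ((i.val + 1 : ℕ) : ZMod k) = i + 1 := by
      rw [Nat.cast_succ, ZMod.natCast_zmod_val]
    have h3 := ZMod.val_lt i
    split_ifs with h
    · have hi : i.val + 1 = k := by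
        have := Nat.le_of_dvd (by omega) ((ZMod.natCast_eq_zero_iff _ _).1 (h2.trans h))
        omega
      rw [hi] at h1
      rw [h, ZMod.val_zero, h1, initialArc]
      simp
    · have hi : i.val + 1 < k := by
        refine lt_of_le_of_ne h3 fun h' => h ?_
        rw [← h2, h', ZMod.natCast_self]
      rw [← h2, ZMod.val_natCast_of_lt hi, h1, sub_zero]
      exact add_sub_cancel_left _ _
  refine cycleContraction f g s ?_ ?_ ?_ (fun _ => cellProj_univ _) (fun _ => cellProj_univ _)
    ?_ ?_ ?_ ?_
  · rintro t (i | i)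
    · simp [f_inl, Finsupp.diag_single, cellDim]
    · rw [f_inr]
      split_ifs <;> simp [cellDim, Finsupp.diag_single]
  · rintro t (_ | _)
    · simp [g_false, Finsupp.diag_single, cellDim]
    · rw [g_true, diag_initialArc, Bool.toNat_true, pow_one]
  · rintro t (i | i)
    · rw [s_inl, diag_initialArc]
      simp [cellDim]
    · simp [s_inr]
  · intro i
    rw [cellBoundaryMap_inr]
    simp [f_inl]
  · rintro (_ | _)
    · rw [g_false, cellBoundaryMap_inl]
    · rw [g_true, cellBoundaryMap_initialArc, ZMod.natCast_self, sub_self]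
  · rintro (_ | _)
    · rw [g_false, f_inl]
    · rw [g_true, f_arc]
  · rintro (i | i)
    · rw [s_inl, cellBoundaryMap_inl, f_inl, cellProj_univ, g_false, cellBoundaryMap_initialArc,
        ZMod.natCast_zmod_val, map_zero, add_zero]
    · rw [s_inr, cellBoundaryMap_inr, f_inr, cellProj_univ, map_sub]
      simp only [Finset.mem_univ, if_true, s_inl, s_edge, map_zero, zero_add]
      split_ifs <;> simp [g_true]

end Full

end VETuple

/-! ### From contractions to homology -/

/-- On cycles `p` is onto, with section `q`, and its kernel is exactly the boundaries: a cycle `x`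
with `p x = 0` bounds because it is homologous to `q (p x)`. -/
theorem CategoryTheory.ShortComplex.homology_equiv_of_retract {R : Type} [CommRing R]
    (S : ShortComplex (ModuleCat.{0} R)) {A : Type} [AddCommGroup A] [Module R A]
    (p : S.X₂ →ₗ[R] A) (q : A →ₗ[R] S.X₂) (hp : ∀ x, p (S.f.hom x) = 0)
    (hq : ∀ a, S.g.hom (q a) = 0) (hpq : ∀ a, p (q a) = a)
    (h : ∀ x, S.g.hom x = 0 → ∃ y, S.f.hom y = x - q (p x)) :
    Nonempty (S.homology ≃ₗ[R] A) := by
  let φ : LinearMap.ker S.g.hom →ₗ[R] A := p ∘ₗ (LinearMap.ker S.g.hom).subtype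
  have hφ : Function.Surjective φ := fun a => ⟨⟨q a, hq a⟩, hpq a⟩
  have hker : LinearMap.range S.moduleCatToCycles = LinearMap.ker φ := by
    refine le_antisymm ?_ ?_
    · rintro _ ⟨y, rfl⟩
      exact hp y
    · rintro ⟨x, hx⟩ hx'
      obtain ⟨y, hy⟩ := h x hx
      refine ⟨y, Subtype.ext ?_⟩
      have hx'' : p x = 0 := hx'
      rw [hx'', map_zero, sub_zero] at hy
      exact hy
  exact ⟨S.moduleCatHomologyIso.toLinearEquiv ≪≫ₗ Submodule.quotEquivOfEq _ _ hker ≪≫ₗ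
    φ.quotKerEquivOfSurjective hφ⟩

theorem ChainComplex.homology_equiv_of_retract {R : Type} [CommRing R]
    (K : ChainComplex (ModuleCat.{0} R) ℕ) (d : ℕ) {A : Type} [AddCommGroup A] [Module R A]
    (p : K.X d →ₗ[R] A) (q : A →ₗ[R] K.X d) (hp : ∀ x, p ((K.d (d + 1) d).hom x) = 0)
    (hq : ∀ j a, (K.d d j).hom (q a) = 0) (hpq : ∀ a, p (q a) = a)
    (h : ∀ x, (∀ j, (K.d d j).hom x = 0) → ∃ y, (K.d (d + 1) d).hom y = x - q (p x)) :
    Nonempty (K.homology d ≃ₗ[R] A) := by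
  obtain ⟨e⟩ := (K.sc' (d + 1) d ((ComplexShape.down ℕ).next d)).homology_equiv_of_retract p q hp
    -- In degree 0 there is no lower degree, and the outgoing differential is zero by shape;
    -- otherwise it is the given one.
    (hq _) hpq (fun x hx => h x fun j => by
      by_cases hj : (ComplexShape.down ℕ).Rel d j
      · obtain rfl := (ComplexShape.down ℕ).next_eq' hj
        exact hx
      · rw [K.shape _ _ hj]; rfl)
  exact ⟨(ShortComplex.homologyMapIso (K.isoSc' (d + 1) d _ (by simp) rfl)).toLinearEquiv ≪≫ₗ e⟩

namespace VETuple

variable {k : ℕ} [NeZero k] {n : ℕ}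

/-- Turns membership into two equations, for the degree and for the vertex support, which the
operators of a contraction visibly preserve or shift. -/
theorem mem_chains_iff (P : Finset (ZMod k)) (d : ℕ) (x : VETuple k n →₀ ℤ) :
    x ∈ chains n P 0 d ↔ Finsupp.diag (fun σ : VETuple k n => 2 ^ σ.dim) x = (2 ^ d : ℤ) • x ∧
      tupleProj n P x = x := by
  classical
  rw [Finsupp.diag_pow_eq_iff, tupleProj, Finsupp.diag_eq_self_iff, ← forall₂_and, chains,
    Finsupp.mem_supported]
  refine forall₂_congr fun σ _ => ?_
  simp only [generators, Set.mem_ofPred_eq, zero_le, and_true]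
  refine and_congr_right fun _ => ?_
  simp only [suppV, Finset.subset_iff, Finset.mem_filter, Finset.mem_univ, true_and,
    forall_exists_index]
  constructor
  · intro h j
    rcases hj : σ j with i | i
    · exact h j hj
    · trivial
  · intro h i j hj
    have := h j
    rwa [hj] at this

theorem boundary_eq_zero_of_mem_chains_zero {P : Finset (ZMod k)} {x : VETuple k n →₀ ℤ}
    (hx : x ∈ chains n P 0 0) : boundary n P x = 0 := by
  rw [boundary, Finsupp.linearCombination_apply]
  refine Finset.sum_eq_zero fun σ hσ => ?_
  have h : σ.dim = 0 := (hx hσ).1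
  refine (congrArg _ (Finset.sum_eq_zero fun j _ => ?_)).trans (smul_zero _)
  have hj : j ∉ σ.edgePositions := by
    rw [Finset.card_eq_zero.1 h]; simp
  rw [boundaryAt]
  rcases hi : σ j with i | i
  · rfl
  · exact absurd ((mem_edgePositions _ _).2 ⟨i, hi⟩) hj

theorem anchoredComplex_d_apply (P : Finset (ZMod k)) (d : ℕ)
    (x : (anchoredComplex n P 0).X (d + 1)) :
    (((anchoredComplex n P 0).d (d + 1) d).hom x : chains n P 0 d).1 =
      boundary n P (x : chains n P 0 (d + 1)).1 := by
  have h : (anchoredComplex n P 0).d (d + 1) d = ModuleCat.ofHom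
      ((boundary n P).restrict (boundary_mem n P 0 d)) :=
    ChainComplex.of_d (fun d => ModuleCat.of ℤ (chains n P 0 d))
      (fun d => ModuleCat.ofHom ((boundary n P).restrict (boundary_mem n P 0 d))) d
  rw [h]
  rfl

/-- The contraction of the ungraded tensor power restricts to each degree: the relations with `θ 2`
place `f`, `g`, `s` in the right degrees, and those with `π` keep `g` and `s` inside the complex. -/
theorem homology_equiv {P : Finset (ZMod k)} {S : Type} {deg : S → ℕ}
    (c : GradedContraction (fun t : ℤ => Finsupp.diag fun c : CycleCell k => t ^ cellDim c)
      (cellBoundaryMap P) (cellProj P) (fun t : ℤ => Finsupp.diag fun s => t ^ deg s)) (d : ℕ) :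
    Nonempty ((anchoredComplex n P 0).homology d ≃ₗ[ℤ]
      ({τ : Fin n → S // ∑ j, deg (τ j) = d} →₀ ℤ)) := by
  let C := tupleContraction c n
  let T : Submodule ℤ ((Fin n → S) →₀ ℤ) := Finsupp.supported ℤ ℤ {τ | ∑ j, deg (τ j) = d}
  have hT (y) : y ∈ T ↔ Finsupp.diag (fun τ : Fin n → S => 2 ^ ∑ j, deg (τ j)) y =
      (2 ^ d : ℤ) • y := by
    rw [Finsupp.diag_pow_eq_iff]; exact Finsupp.mem_supported _ _
  have hf : ∀ x ∈ chains n P 0 d, C.f x ∈ T := by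
    intro x hx
    rw [hT]
    refine (LinearMap.congr_fun (C.θ_f 2) x).trans ?_
    rw [LinearMap.comp_apply, ((mem_chains_iff _ _ _).1 hx).1, map_smul]
  have hg : ∀ y ∈ T, C.g y ∈ chains n P 0 d := by
    intro y hy
    rw [mem_chains_iff]
    refine ⟨(LinearMap.congr_fun (C.θ_g 2) y).trans ?_, LinearMap.congr_fun C.π_g y⟩
    rw [LinearMap.comp_apply, (hT y).1 hy, map_smul]
  have hs : ∀ x ∈ chains n P 0 d, C.s x ∈ chains n P 0 (d + 1) := by
    intro x hx
    rw [mem_chains_iff]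
    refine ⟨(LinearMap.congr_fun (C.θ_s 2) x).trans ?_, LinearMap.congr_fun C.π_s x⟩
    rw [LinearMap.smul_apply, LinearMap.comp_apply, ((mem_chains_iff _ _ _).1 hx).1, map_smul,
      smul_smul, pow_succ']
  suffices key : Nonempty ((anchoredComplex n P 0).homology d ≃ₗ[ℤ] T) by
    obtain ⟨e⟩ := key
    exact ⟨e ≪≫ₗ Finsupp.supportedEquivFinsupp _⟩
  refine (anchoredComplex n P 0).homology_equiv_of_retract d (C.f.restrict hf)
    (C.g.restrict hg) (fun x => Subtype.ext ?_) ?_ (fun y => Subtype.ext ?_) ?_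
  · refine (congrArg C.f (anchoredComplex_d_apply P d x)).trans ?_
    exact LinearMap.congr_fun C.f_D _
  · intro j y
    by_cases hj : (ComplexShape.down ℕ).Rel d j
    · obtain rfl : j + 1 = d := hj
      refine Subtype.ext ((anchoredComplex_d_apply P j _).trans ?_)
      exact LinearMap.congr_fun C.D_g _
    · rw [HomologicalComplex.shape _ _ _ hj]; rfl
  · exact LinearMap.congr_fun C.f_g y.1
  · intro x hx
    -- In degree 0 the complex has no outgoing differential to speak of, so the vanishing of the
    -- ungraded boundary is a separate fact: there are no edges to replace.
    have hD : boundary n P (x : chains n P 0 d).1 = 0 := by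
      rcases d with _ | d
      · exact boundary_eq_zero_of_mem_chains_zero (x : chains n P 0 0).2
      · rw [← anchoredComplex_d_apply, hx]; rfl
    refine ⟨(⟨C.s (x : chains n P 0 d).1, hs _ (x : chains n P 0 d).2⟩ : chains n P 0 (d + 1)),
      Subtype.ext ((anchoredComplex_d_apply P d _).trans ?_)⟩
    -- For a cycle in the complex `D x = 0` and `π x = x`, so the homotopy identity reads `D (s x) =
    -- x - g (f x)`.
    have := LinearMap.congr_fun C.homotopy (x : chains n P 0 d).1
    rw [LinearMap.add_apply, LinearMap.comp_apply, LinearMap.comp_apply, hD, map_zero, add_zero,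
      LinearMap.sub_apply, ((mem_chains_iff _ _ _).1 (x : chains n P 0 d).2).2] at this
    exact this

theorem homology_equiv_of_card {P : Finset (ZMod k)} {S : Type} [Fintype S] {deg : S → ℕ}
    (c : GradedContraction (fun t : ℤ => Finsupp.diag fun c : CycleCell k => t ^ cellDim c)
      (cellBoundaryMap P) (cellProj P) (fun t : ℤ => Finsupp.diag fun s => t ^ deg s)) (d m : ℕ)
    (hm : Fintype.card {τ : Fin n → S // ∑ j, deg (τ j) = d} = m) :
    Nonempty ((anchoredComplex n P 0).homology d ≃ₗ[ℤ] (Fin m → ℤ)) := by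
  obtain ⟨e⟩ := homology_equiv (n := n) c d
  exact ⟨e ≪≫ₗ Finsupp.domLCongr (Fintype.equivFinOfCardEq hm) ≪≫ₗ
    Finsupp.linearEquivFunOnFinite ℤ ℤ (Fin m)⟩

theorem card_bool_tuples (n d : ℕ) :
    Fintype.card {τ : Fin n → Bool // ∑ j, (τ j).toNat = d} = n.choose d := by
  -- A tuple of classes is the set of positions carrying the loop class, and its degree is the size
  -- of that set.
  let e : (Fin n → Bool) ≃ Finset (Fin n) :=
    { toFun := fun τ => Finset.univ.filter fun j => τ j = true
      invFun := fun s j => decide (j ∈ s)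
      left_inv := fun τ => by ext j; simp
      right_inv := fun s => by ext j; simp }
  rw [Fintype.card_congr (e.subtypeEquiv (q := fun s => s.card = d) fun τ => ?_),
    Fintype.card_finset_len, Fintype.card_fin]
  rw [show (e τ).card = ∑ j, (τ j).toNat from ?_]
  refine (Finset.card_filter _ _).trans (Finset.sum_congr rfl fun j _ => ?_)
  cases τ j <;> rfl

theorem homology_univ_equiv (n d : ℕ) :
    Nonempty ((anchoredComplex n (Finset.univ : Finset (ZMod k)) 0).homology d ≃ₗ[ℤ]
      (Fin (n.choose d) → ℤ)) :=
  homology_equiv_of_card (fullContraction k) d _ (card_bool_tuples n d)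

theorem homology_proper_equiv {P : Finset (ZMod k)} (hP : P ≠ Finset.univ) (n : ℕ) :
    Nonempty ((anchoredComplex n P 0).homology n ≃ₗ[ℤ] (Fin (Pᶜ.card ^ n) → ℤ)) := by
  refine homology_equiv_of_card (properContraction hP) n _ ?_
  rw [Fintype.card_congr (Equiv.subtypeUnivEquiv fun τ => by simp), Fintype.card_fun,
    Fintype.card_fin, Fintype.card_subtype_compl, Finset.card_compl, Fintype.card_coe]

theorem homology_proper_subsingleton {P : Finset (ZMod k)} (hP : P ≠ Finset.univ) {n d : ℕ}
    (hd : d ≠ n) : Subsingleton ((anchoredComplex n P 0).homology d) := by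
  obtain ⟨e⟩ := homology_equiv (n := n) (properContraction hP) d
  have : IsEmpty {τ : Fin n → {i // i ∉ P} // ∑ _j : Fin n, 1 = d} :=
    ⟨fun τ => hd (by simpa using τ.2.symm)⟩
  exact e.toEquiv.subsingleton

end VETuple

/-! ### Comparison with the cubical chain complex of the product -/

namespace CubicalCx

/-- The cell `x × y` of the direct product. -/
def pair (X Y : CubicalCx) (x : X.Cell) (y : Y.Cell) : (X.prod Y).Cell := (x, y)

/-- The directions of `y` come after those of `x`, so their indices are shifted by `X.dim x`; this
shift is the Koszul sign. -/
theorem prod_cellBoundary (X Y : CubicalCx) (x : X.Cell) (y : Y.Cell) :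
    (X.prod Y).cellBoundary (X.pair Y x y) =
      Finsupp.mapDomain (fun x => X.pair Y x y) (X.cellBoundary x) +
      (-1 : ℤ) ^ X.dim x • Finsupp.mapDomain (fun y => X.pair Y x y) (Y.cellBoundary y) := by
  have h2 (ε i) (hi : i < X.dim x) : (X.prod Y).face ε i (X.pair Y x y) =
    X.pair Y (X.face ε i x) y := if_pos hi
  have h3 (ε i) : (X.prod Y).face ε (X.dim x + i) (X.pair Y x y) = X.pair Y x (Y.face ε i y) :=
    (if_neg (by simp [pair])).trans (by simp only [pair, Nat.add_sub_cancel_left]; rfl)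
  refine (Finset.sum_range_add _ (X.dim x) (Y.dim y)).trans ?_
  rw [cellBoundary, cellBoundary,
    Finsupp.mapDomain_finsetSum, Finsupp.mapDomain_finsetSum, Finset.smul_sum]
  congr 1
  · refine Finset.sum_congr rfl fun i hi => ?_
    rw [h2 _ _ (Finset.mem_range.1 hi), h2 _ _ (Finset.mem_range.1 hi), Finsupp.mapDomain_smul,
      Finsupp.mapDomain_sub, Finsupp.mapDomain_single, Finsupp.mapDomain_single]
  · refine Finset.sum_congr rfl fun i _ => ?_
    rw [h3, h3, Finsupp.mapDomain_smul, Finsupp.mapDomain_sub, Finsupp.mapDomain_single,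
      Finsupp.mapDomain_single, smul_smul, pow_add]

theorem chainComplex_d_apply (X : CubicalCx) (d : ℕ) (x : X.chainComplex.X (d + 1)) :
    ((X.chainComplex.d (d + 1) d).hom x : X.chains d).1 = X.boundary (x : X.chains (d + 1)).1 := by
  have h : X.chainComplex.d (d + 1) d = ModuleCat.ofHom
      (X.boundary.restrict (X.boundary_mem d)) :=
    ChainComplex.of_d (fun d => ModuleCat.of ℤ (X.chains d))
      (fun d => ModuleCat.ofHom (X.boundary.restrict (X.boundary_mem d))) d
  rw [h]
  rfl

theorem tupleCell_bijective (X : CubicalCx) (n : ℕ) : Function.Bijective (X.tupleCell n) := by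
  induction n with
  | zero => exact ⟨fun _ _ _ => Subsingleton.elim _ _, fun c => ⟨Fin.elim0, rfl⟩⟩
  | succ n ih =>
    constructor
    · intro σ τ h
      have h1 : σ 0 = τ 0 := congrArg Prod.fst h
      have h2 : Fin.tail σ = Fin.tail τ := ih.1 (congrArg Prod.snd h)
      rw [← Fin.cons_self_tail σ, ← Fin.cons_self_tail τ, h1, h2]
    · rintro ⟨c, c'⟩
      obtain ⟨σ, rfl⟩ := ih.2 c'
      exact ⟨Fin.cons c σ, rfl⟩

end CubicalCx

namespace VETuple

variable {k n : ℕ}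

theorem dim_tupleCell (σ : VETuple k n) :
    ((cycleGraphCx k).pow n).dim ((cycleGraphCx k).tupleCell n σ) = σ.dim := by
  induction n with
  | zero => rw [dim_eq_sum]; rfl
  | succ n ih =>
    rw [← Fin.cons_self_tail σ, dim_cons, ← ih (Fin.tail σ)]
    rfl

/-- A vertex or edge as a cell of the cubical complex `C_k`. -/
def toCell (c : CycleCell k) : (cycleGraphCx k).Cell := c

/-- `CubicalCx.tupleCell` for vertex-edge tuples. -/
def toPowCell (n : ℕ) (σ : VETuple k n) : ((cycleGraphCx k).pow n).Cell :=
  (cycleGraphCx k).tupleCell n σ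

theorem cycleGraphCx_cellBoundary [NeZero k] (c : CycleCell k) :
    (cycleGraphCx k).cellBoundary (toCell c) =
      Finsupp.mapDomain toCell (cellBoundary Finset.univ c) := by
  rcases c with i | i
  · exact (Finset.sum_range_zero _).trans Finsupp.mapDomain_zero.symm
  · refine (Finset.sum_range_one _).trans ?_
    simp only [pow_zero, one_smul, cellBoundary, Sum.elim_inr, Finset.mem_univ, if_true,
      Finsupp.mapDomain_sub, Finsupp.mapDomain_single]
    rfl

/-- Induction on `n`: both boundaries obey the same Leibniz rule and agree on a single cell of the
cycle. -/
theorem pow_cellBoundary [NeZero k] (σ : VETuple k n) :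
    ((cycleGraphCx k).pow n).cellBoundary (toPowCell n σ) =
      Finsupp.mapDomain (toPowCell n) (tupleBoundary Finset.univ σ) := by
  induction n with
  | zero =>
    refine (Finset.sum_range_zero _).trans ?_
    rw [tupleBoundary, Finset.univ_eq_empty, Finset.sum_empty, Finsupp.mapDomain_zero]
  | succ n ih =>
    obtain ⟨c, σ, rfl⟩ : ∃ (c : CycleCell k) (τ : VETuple k n), σ = Fin.cons c τ :=
      ⟨σ 0, Fin.tail σ, (Fin.cons_self_tail σ).symm⟩
    refine (CubicalCx.prod_cellBoundary (cycleGraphCx k) ((cycleGraphCx k).pow n) (toCell c)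
      (toPowCell n σ)).trans ?_
    rw [ih, cycleGraphCx_cellBoundary, tupleBoundary_cons, Finsupp.mapDomain_add,
      Finsupp.mapDomain_smul, ← Finsupp.mapDomain_comp, ← Finsupp.mapDomain_comp,
      ← Finsupp.mapDomain_comp, ← Finsupp.mapDomain_comp]
    rfl

/-- The linear extension of the bijection from tuples to cells of the `n`-fold product. -/
noncomputable def cellLinearEquiv (k n : ℕ) :
    (VETuple k n →₀ ℤ) ≃ₗ[ℤ] (((cycleGraphCx k).pow n).Cell →₀ ℤ) :=
  Finsupp.domLCongr (Equiv.ofBijective (toPowCell n) ((cycleGraphCx k).tupleCell_bijective n))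

theorem cellLinearEquiv_apply (x : VETuple k n →₀ ℤ) :
    cellLinearEquiv k n x = Finsupp.mapDomain (toPowCell n) x :=
  Finsupp.equivMapDomain_eq_mapDomain _ _

variable [NeZero k]

theorem cellLinearEquiv_boundary (x : VETuple k n →₀ ℤ) :
    cellLinearEquiv k n (boundary n Finset.univ x) =
      ((cycleGraphCx k).pow n).boundary (cellLinearEquiv k n x) := by
  suffices h : (cellLinearEquiv k n).toLinearMap ∘ₗ boundary n Finset.univ =
      ((cycleGraphCx k).pow n).boundary ∘ₗ (cellLinearEquiv k n).toLinearMap from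
    LinearMap.congr_fun h x
  refine Finsupp.lhom_ext' fun σ => LinearMap.ext_ring ?_
  simp only [LinearMap.comp_apply, Finsupp.lsingle_apply, LinearEquiv.coe_coe, boundary_single,
    cellLinearEquiv_apply, Finsupp.mapDomain_single, CubicalCx.boundary,
    Finsupp.linearCombination_single, one_smul, pow_cellBoundary]

theorem map_chains (d : ℕ) :
    (chains n (Finset.univ : Finset (ZMod k)) 0 d).map (cellLinearEquiv k n).toLinearMap =
      ((cycleGraphCx k).pow n).chains d := by
  -- With `P` everything and `q = 0` the support conditions are empty, so only the dimension
  -- remains.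
  have h : generators n (Finset.univ : Finset (ZMod k)) 0 d = {σ | σ.dim = d} := by
    ext σ
    simp [generators]
  have h2 : (cellLinearEquiv k n).toLinearMap = Finsupp.lmapDomain ℤ ℤ (toPowCell n) :=
    LinearMap.ext cellLinearEquiv_apply
  rw [chains, h, h2, Finsupp.lmapDomain_supported, CubicalCx.chains]
  congr 1
  ext c
  obtain ⟨σ, rfl⟩ := ((cycleGraphCx k).tupleCell_bijective n).2 c
  refine (((cycleGraphCx k).tupleCell_bijective n).1.mem_set_image (s := {σ | dim σ = d})).trans ?_
  exact (congrArg (· = d) (dim_tupleCell σ)).symm.to_iff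

/-- `𝒞^{ℤ/k, 0}` is the cubical chain complex of the `n`-fold product of the cycle graph. -/
noncomputable def anchoredComplexIso (k n : ℕ) [NeZero k] :
    anchoredComplex n (Finset.univ : Finset (ZMod k)) 0 ≅
      ((cycleGraphCx k).pow n).chainComplex :=
  HomologicalComplex.Hom.isoOfComponents
    (fun d => ((cellLinearEquiv k n).ofSubmodules (chains n Finset.univ 0 d)
      (((cycleGraphCx k).pow n).chains d) (map_chains d)).toModuleIso) (by
    rintro _ j rfl
    refine ModuleCat.hom_ext (LinearMap.ext fun x => Subtype.ext ?_)
    refine (CubicalCx.chainComplex_d_apply _ j _).trans ?_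
    refine (cellLinearEquiv_boundary (x : chains n Finset.univ 0 (j + 1)).1).symm.trans ?_
    exact congrArg (cellLinearEquiv k n) (anchoredComplex_d_apply _ j x).symm)

theorem anchoredComplexIso_tupleChain (d : ℕ) (σ : VETuple k n)
    (hσ : σ ∈ generators n Finset.univ 0 d)
    (hc : ((cycleGraphCx k).pow n).dim ((cycleGraphCx k).tupleCell n σ) = d) :
    ((anchoredComplexIso k n).hom.f d).hom (tupleChain Finset.univ 0 σ hσ) =
      ((cycleGraphCx k).pow n).cellChain ((cycleGraphCx k).tupleCell n σ) hc := by
  refine Subtype.ext ((cellLinearEquiv_apply (Finsupp.single σ 1)).trans ?_)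
  exact Finsupp.mapDomain_single

end VETuple

theorem proposition4p1 (k n : ℕ) [NeZero k] (hk : 2 ≤ k) :
    ((∀ i : ℕ, Nonempty ((anchoredComplex n (Finset.univ : Finset (ZMod k)) 0).homology i ≅
        singularHomologyZ (UnitAddTorus (Fin n)) i)) ∧
      ∃ e : anchoredComplex n (Finset.univ : Finset (ZMod k)) 0 ≅
          ((cycleGraphCx k).pow n).chainComplex,
        ∀ (d : ℕ) (σ : VETuple k n) (hσ : σ ∈ VETuple.generators n Finset.univ 0 d),
          ∃ hc : ((cycleGraphCx k).pow n).dim ((cycleGraphCx k).tupleCell n σ) = d,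
            (e.hom.f d).hom (tupleChain Finset.univ 0 σ hσ) =
              ((cycleGraphCx k).pow n).cellChain ((cycleGraphCx k).tupleCell n σ) hc) ∧
    (∀ P : Finset (ZMod k), P ≠ Finset.univ →
      Nonempty ((anchoredComplex n P 0).homology n ≃ₗ[ℤ] (Fin (Pᶜ.card ^ n) → ℤ)) ∧
      ∀ i : ℕ, i ≠ n → Subsingleton ((anchoredComplex n P 0).homology i)) := by
  refine ⟨⟨fun i => ?_, VETuple.anchoredComplexIso k n, fun d σ hσ =>
    ⟨(VETuple.dim_tupleCell σ).trans hσ.1, VETuple.anchoredComplexIso_tupleChain d σ hσ _⟩⟩,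
    fun P hP => ⟨VETuple.homology_proper_equiv hP n,
      fun i hi => VETuple.homology_proper_subsingleton hP hi⟩⟩
  -- Both homology groups are free of rank `n.choose i`.
  obtain ⟨e⟩ := VETuple.homology_univ_equiv (k := k) n i
  obtain ⟨e'⟩ := singularHomologyZ_torus n i
  exact ⟨(e ≪≫ₗ e'.symm).toModuleIso⟩
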